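/- **Setting.** There are $n=3f+1$ processes $p_1,\dots,p_n$, of which at most $f$ are Byzantine and the others correct; a *quorum* is a set of $2f+1$ processes. Correct processes exchange messages over authenticated point-to-point links, can sign messages (signatures cannot be forged) and use a collision-resistant hash function $\mathsf{hash}$; local processing takes zero time, and only finitely many steps are taken in bounded time. There are times $\mathsf{GST}\ge 0$ and $\delta>0$, unknown to the processes, such that a message sent between correct processes at a time $t\ge\mathsf{GST}$ is received by $t+\delta$; messages sent earlier may be arbitrarily delayed or lost, but messages to oneself are always received at once. The local clocks of correct processes are non-decreasing, arbitrary before $\mathsf{GST}$, and advance at the rate of real time after $\mathsf{GST}$. Timers are measured on local clocks. Views are positive integers; $\mathsf{leader}(v)=p_{((v-1)\bmod n)+1}$. Let $\rho>0$, let $F$ be a non-decreasing real function on $\{0,1,2,\dots\}$ with $F(0)=0$, and $F_p$ a real function on the views. Every correct process $p_i$ has a valid value $\mathsf{myval}()$ (validity is given by a predicate $\mathsf{valid}$) and calls $\mathtt{start}()$ exactly once. **FastSync** (at $p_i$; all variables are initially $0$, $\mathsf{timer\_view}$ is off). On $\mathtt{start}()$: if $\mathsf{view}^+=0$, send $\mathtt{WISH}(1)$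 to all. When $\mathsf{timer\_view}$ expires: send $\mathtt{WISH}(\max(\mathsf{view}+1,\mathsf{view}^+))$ to all. Every $\rho$ units of local time: if $\mathsf{timer\_view}$ is running, send $\mathtt{WISH}(\mathsf{view}^+)$ to all; otherwise, if $\mathsf{max\_views}[i]>0$, send $\mathtt{WISH}(\max(\mathsf{view}+1,\mathsf{view}^+))$ to all. On receiving $\mathtt{WISH}(v)$ from $p_j$: set $\mathsf{max\_views}[j]$ to $\max(\mathsf{max\_views}[j],v)$; set $\mathsf{view}$ and $\mathsf{view}^+$ to the $(2f+1)$-st and the $(f+1)$-st highest entries of $\mathsf{max\_views}$; if now $\mathsf{view}=\mathsf{view}^+$ and $\mathsf{view}$ has increased, restart $\mathsf{timer\_view}$ with duration $F(\mathsf{view})$ and enter this view (trigger $\mathtt{new\_view}(\mathsf{view})$); if $\mathsf{view}^+$ has increased, send $\mathtt{WISH}(\mathsf{view}^+)$ to all. **Two-phase HotStuff** (at $p_i$; all messages are signed by their senders, and they are stored when received). For a set $C$ of signed messages, $\mathsf{prepared}(C,v,h)$ means $C=\{\langle\mathtt{PREPARED}(v,h)\rangle_j\mid p_j\in Q\}$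 for some quorum $Q$. Initially $\mathsf{curr\_view}$, $\mathsf{prepared\_view}$, $\mathsf{locked\_view}$ are $0$, $\mathsf{cert}=\bot$. - On $\mathtt{new\_view}(v)$: set $\mathsf{curr\_view}=v$, $\mathsf{voted}=\text{false}$; stop $\mathsf{timer\_newleader}$ and, if $p_i=\mathsf{leader}(v)$, start it with duration $F_p(v)$; send $\mathtt{NEWLEADER}(v,\mathsf{prepared\_view},\mathsf{prepared\_val},\mathsf{cert})$ to $\mathsf{leader}(v)$. - When $\mathsf{timer\_newleader}$ expires at $p_i=\mathsf{leader}(v)$, $v=\mathsf{curr\_view}$: take one valid message $\mathtt{NEWLEADER}(v,\mathit{view}_j,\mathit{val}_j,\mathit{cert}_j)$ for each process $p_j$ from which one has been received (valid: $\mathit{view}_j<v$, and $\mathit{view}_j\ne0$ implies $\mathsf{prepared}(\mathit{cert}_j,\mathit{view}_j,\mathsf{hash}(\mathit{val}_j))$). If some $\mathit{view}_j\neq0$, send $\mathtt{PROPOSE}(v,\mathit{val}_j,\mathit{cert}_j)$ to all for a $j$ with the maximal $\mathit{view}_j$; otherwise send $\mathtt{PROPOSE}(v,\mathsf{myval}(),\bot)$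 to all. - When $\mathtt{PROPOSE}(v,x,C)$ has been received from $\mathsf{leader}(v)$, $v=\mathsf{curr\_view}$, $\mathsf{voted}$ is false, $\mathsf{valid}(x)$ holds, and $\mathsf{locked\_view}=0$ or $x=\mathsf{prepared\_val}$ or $\mathsf{prepared}(C,v',\mathsf{hash}(x))$ for some $v'$ with $\mathsf{locked\_view}<v'<v$: set $\mathsf{curr\_val}=x$, $\mathsf{voted}=\text{true}$ and send $\mathtt{PREPARED}(v,\mathsf{hash}(x))$ to all. - When $\mathsf{voted}$ is true and a set $C$ of messages $\mathtt{PREPARED}(\mathsf{curr\_view},\mathsf{hash}(\mathsf{curr\_val}))$ from a quorum has been received (once per view): set $\mathsf{prepared\_val}=\mathsf{curr\_val}$, $\mathsf{prepared\_view}=\mathsf{locked\_view}=\mathsf{curr\_view}$, $\mathsf{cert}=C$ and send $\mathtt{COMMITTED}(\mathsf{curr\_view},\mathsf{hash}(\mathsf{curr\_val}))$ to all. - When $\mathsf{locked\_view}=\mathsf{curr\_view}$ and $\mathtt{COMMITTED}(\mathsf{curr\_view},\mathsf{hash}(\mathsf{curr\_val}))$ has been received from a quorum: decide $\mathsf{curr\_val}$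 (once). **Notation.** $\mathsf{GV}(t)$ is the highest view entered by a correct process at or before time $t$ ($0$ if there is none), and $t_{\mathrm{first}}^{f+1}$ is the earliest time by which $f+1$ correct processes have called $\mathtt{start}()$. **Claim.** Consider any execution of two-phase HotStuff over FastSync and let $v=\mathsf{GV}(\mathsf{GST}+\rho)+1$. Assume that $t_{\mathrm{first}}^{f+1}\le\mathsf{GST}+\rho$ and that $F_p(k)>3\delta$ and $F(k)-F_p(k)>5\delta$ for all views $k$ with $v\le k\le v+f$ (if $F_p$ and $F-F_p$ are non-decreasing on the views, it is enough that this holds for $k=v$). Then every correct process decides no later than $$\mathsf{GST}+\rho+\sum_{k=v-1}^{v+f-1}\bigl(F(k)+\delta\bigr)+F_p(v+f)+5\delta .$$ -/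

import Mathlib

namespace TwoPhaseHotStuff

/-! ### Protocol parameters, messages, local states

Processes are the elements of `Fin (3 * f + 1)`.  Views are natural numbers; view `0` is a dummy
("no view").  Times and clock values are real numbers. -/

/-- A certificate: a set of signed messages `⟨PREPARED(v, h)⟩_j`, written `(j, v, h)`.
The empty set plays the role of `⊥`. -/
abbrev Cert (n : ℕ) (Hash : Type*) := Set (Fin n × ℕ × Hash)

/-- The data known to the processes. -/
structure Protocol (Value Hash : Type*) where
  /-- resilience: there are `3 f + 1` processes, at most `f` of which are faulty -/
  f : ℕ
  /-- duration of the view timer of the synchronizer -/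
  F : ℕ → ℝ
  /-- duration of the timer after which a leader makes its proposal -/
  Fp : ℕ → ℝ
  /-- retransmission period of the synchronizer -/
  ρ : ℝ
  hash : Value → Hash
  valid : Value → Prop
  /-- the value `myval()` proposed by each process -/
  myval : Fin (3 * f + 1) → Value

/-- The environment, unknown to the processes. -/
structure Env (n : ℕ) where
  GST : ℝ
  δ : ℝ
  /-- the set of correct processes -/
  correct : Finset (Fin n)
  /-- `clock i t` is the reading of the hardware clock of `i` at real time `t` -/
  clock : Fin n → ℝ → ℝ

inductive Msg (n : ℕ) (Value Hash : Type*) where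
  | wish (v : ℕ)
  | newLeader (v preparedView : ℕ) (preparedVal : Option Value) (cert : Cert n Hash)
  | propose (v : ℕ) (x : Value) (cert : Cert n Hash)
  | prepared (v : ℕ) (h : Hash)
  | committed (v : ℕ) (h : Hash)

/-- The certificate attached to a message (empty if there is none). -/
def Msg.cert {n : ℕ} {Value Hash : Type*} : Msg n Value Hash → Cert n Hash
  | .newLeader _ _ _ C => C
  | .propose _ _ C => C
  | _ => ∅

/-- The value `x` is transmitted in clear in the message. -/
def Msg.Carries {n : ℕ} {Value Hash : Type*} : Msg n Value Hash → Value → Prop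
  | .newLeader _ _ val _, x => val = some x
  | .propose _ y _, x => y = x
  | _, _ => False

/-- Local state of a process.  Running timers are represented by the value of the local clock at
which they expire; `none` means that the timer is not running. -/
structure PState (n : ℕ) (Value Hash : Type*) where
  -- synchronizer
  /-- `maxViews j` is the highest view in a `WISH` message received from `j` -/
  maxViews : Fin n → ℕ
  view : ℕ
  viewPlus : ℕ
  viewTimer : Option ℝ
  /-- local time of the next periodic retransmission -/
  retransmitAt : ℝ
  -- consensus protocol
  currView : ℕ
  voted : Bool
  currVal : Option Value
  preparedVal : Option Value
  preparedView : ℕ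
  lockedView : ℕ
  cert : Cert n Hash
  newLeaderTimer : Option ℝ
  /-- the signed consensus messages received so far, with their signers -/
  received : Set (Fin n × Msg n Value Hash)
  decided : Option Value

/-- Steps of a process: invocation of `start()`, expiry of the view timer, periodic retransmission,
receipt of a message `m` from `j`, and the handlers of the consensus protocol. -/
inductive Action (n : ℕ) (Value Hash : Type*) where
  | start
  | viewTimeout
  | retransmit
  | receive (j : Fin n) (m : Msg n Value Hash)
  | propose
  | vote
  | prepare
  | decide (x : Value)

/-- Actions that a process takes by itself, without input from the outside. -/
def Action.Internal {n : ℕ} {Value Hash : Type*} : Action n Value Hash → Prop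
  | .start => False
  | .receive _ _ => False
  | _ => True

/-! ### Ingredients of the pseudocode -/

/-- `max {v | (∃ k, mv k = v) ∧ #{j | mv j ≥ v} ≥ q}`: the `q`-th highest entry of `mv`. -/
def highest {n : ℕ} (q : ℕ) (mv : Fin n → ℕ) : ℕ :=
  Finset.univ.sup fun k =>
    if q ≤ (Finset.univ.filter fun j => mv k ≤ mv j).card then mv k else 0

/-- `C = {⟨PREPARED(v, h)⟩_j | j ∈ Q}` for a quorum `Q`, i.e. a set of `2 f + 1` processes. -/
def PreparedCert {n : ℕ} {Hash : Type*} (f : ℕ) (C : Cert n Hash) (v : ℕ) (h : Hash) : Prop :=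
  ∃ Q : Finset (Fin n), Q.card = 2 * f + 1 ∧ C = {s | s.1 ∈ Q ∧ s.2 = (v, h)}

namespace Protocol

variable {Value Hash : Type*} (P : Protocol Value Hash)

/-- number of processes -/
abbrev n : ℕ := 3 * P.f + 1

/-- Leaders rotate round-robin, the leader of view `1` being the first process. -/
def leader (v : ℕ) : Fin P.n := ⟨(v - 1) % P.n, Nat.mod_lt _ (Nat.succ_pos _)⟩

/-- `ValidNewLeader(⟨NEWLEADER(v', v, val, C)⟩)` -/
def ValidNewLeader (v' v : ℕ) (val : Option Value) (C : Cert P.n Hash) : Prop :=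
  v < v' ∧ (v ≠ 0 → ∃ x, val = some x ∧ PreparedCert P.f C v (P.hash x))

/-- `SafeProposal(⟨PROPOSE(v, x, C)⟩_j)` at a process in state `σ` -/
def SafeProposal (σ : PState P.n Value Hash) (j : Fin P.n) (v : ℕ) (x : Value)
    (C : Cert P.n Hash) : Prop :=
  j = P.leader v ∧ P.valid x ∧
    (σ.lockedView ≠ 0 →
      σ.preparedVal = some x ∨
        ∃ v', σ.lockedView < v' ∧ v' < v ∧ PreparedCert P.f C v' (P.hash x))

/-- The processes a message is sent to: `NEWLEADER(v, …)` is sent to the leader of `v`,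
all other messages are sent to all processes. -/
def SentTo : Msg P.n Value Hash → Fin P.n → Prop
  | .newLeader v _ _ _, j => j = P.leader v
  | _, _ => True

/-- State update of the handler `new_view(v)` at `i`, when its clock reads `c`. -/
noncomputable def newView (i : Fin P.n) (c : ℝ) (v : ℕ) (σ : PState P.n Value Hash) :
    PState P.n Value Hash :=
  { σ with
    currView := v
    voted := false
    newLeaderTimer := if i = P.leader v then some (c + P.Fp v) else none }

/-- Updates of the synchronizer variables when `WISH(v)` is received from `j`. -/
def recordWish (j : Fin P.n) (v : ℕ) (σ : PState P.n Value Hash) : PState P.n Value Hash :=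
  let mv := Function.update σ.maxViews j (max (σ.maxViews j) v)
  { σ with
    maxViews := mv
    view := highest (2 * P.f + 1) mv
    viewPlus := highest (P.f + 1) mv }

/-- View entry condition, where `σ` and `σ'` are the states before and after `recordWish`. -/
def EntersOn (σ σ' : PState P.n Value Hash) : Prop :=
  σ'.viewPlus = σ'.view ∧ σ.view < σ'.view

/-- The choice of the proposal by the leader of view `v` in state `σ`: `S` is the set of processes
from which a valid `NEWLEADER` message for `v` has been received, and `sel` selects one such message
for each of them. The proposal is the value (with its certificate) prepared in the highest view, or
`myval()` if nothing has been prepared. -/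
def ChoosesProposal (i : Fin P.n) (σ : PState P.n Value Hash) (v : ℕ) (x : Value)
    (C : Cert P.n Hash) : Prop :=
  ∃ (S : Set (Fin P.n)) (sel : Fin P.n → ℕ × Option Value × Cert P.n Hash),
    (∀ j, j ∈ S ↔ ∃ w val D, (j, Msg.newLeader v w val D) ∈ σ.received ∧
      P.ValidNewLeader v w val D) ∧
    (∀ j ∈ S, (j, Msg.newLeader v (sel j).1 (sel j).2.1 (sel j).2.2) ∈ σ.received ∧
      P.ValidNewLeader v (sel j).1 (sel j).2.1 (sel j).2.2) ∧
    ((∃ j ∈ S, (sel j).1 ≠ 0 ∧ (∀ k ∈ S, (sel k).1 ≤ (sel j).1) ∧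
        (sel j).2.1 = some x ∧ (sel j).2.2 = C) ∨
      ((∀ j ∈ S, (sel j).1 = 0) ∧ x = P.myval i ∧ C = ∅))

open Classical in
/-- `P.Step i c a σ σ' out`: when its clock reads `c`, process `i` can take the step `a` from state
`σ` to state `σ'`, sending the messages in `out`. The first five constructors are the synchronizer
FastSync (whose upcall `new_view` is executed in place) and the remaining ones are the handlers of
two-phase HotStuff. -/
inductive Step (i : Fin P.n) (c : ℝ) : Action P.n Value Hash → PState P.n Value Hash →
    PState P.n Value Hash → Set (Msg P.n Value Hash) → Prop
  /-- `start()`: if `view⁺ = 0` then send `WISH(1)` to all -/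
  | start (σ : PState P.n Value Hash) :
      Step i c .start σ σ (if σ.viewPlus = 0 then {.wish 1} else ∅)
  /-- when `timer_view` expires: send `WISH(max(view + 1, view⁺))` to all -/
  | viewTimeout (σ : PState P.n Value Hash) (d : ℝ) (hd : σ.viewTimer = some d) (hc : d ≤ c) :
      Step i c .viewTimeout σ { σ with viewTimer := none }
        {.wish (max (σ.view + 1) σ.viewPlus)}
  /-- every `ρ` units of local time: if `timer_view` is enabled, send `WISH(view⁺)` to all,
  else if `max_views[i] > 0`, send `WISH(max(view + 1, view⁺))` to all -/
  | retransmit (σ : PState P.n Value Hash) (hc : σ.retransmitAt ≤ c) :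
      Step i c .retransmit σ { σ with retransmitAt := c + P.ρ }
        (if σ.viewTimer.isSome then {.wish σ.viewPlus}
          else if 0 < σ.maxViews i then {.wish (max (σ.view + 1) σ.viewPlus)} else ∅)
  /-- receipt of `WISH(v)` without view entry: if `view⁺` has grown, send `WISH(view⁺)` to all -/
  | receiveWish (σ σ₁ : PState P.n Value Hash) (j : Fin P.n) (v : ℕ)
      (hσ₁ : σ₁ = P.recordWish j v σ) (hE : ¬ P.EntersOn σ σ₁) :
      Step i c (.receive j (.wish v)) σ σ₁
        (if σ.viewPlus < σ₁.viewPlus then {.wish σ₁.viewPlus} else ∅)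
  /-- receipt of `WISH(v)` with view entry: additionally, restart `timer_view` with duration
  `F(view)` and trigger `new_view(view)`, which sends a `NEWLEADER` message to the leader -/
  | enterView (σ σ₁ : PState P.n Value Hash) (j : Fin P.n) (v : ℕ)
      (hσ₁ : σ₁ = P.recordWish j v σ) (hE : P.EntersOn σ σ₁) :
      Step i c (.receive j (.wish v)) σ
        (P.newView i c σ₁.view { σ₁ with viewTimer := some (c + P.F σ₁.view) })
        ({.newLeader σ₁.view σ.preparedView σ.preparedVal σ.cert} ∪
          if σ.viewPlus < σ₁.viewPlus then {.wish σ₁.viewPlus} else ∅)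
  /-- receipt of a signed message of the consensus protocol, which is stored -/
  | receiveOther (σ : PState P.n Value Hash) (j : Fin P.n) (m : Msg P.n Value Hash)
      (hm : ∀ v, m ≠ .wish v) :
      Step i c (.receive j m) σ { σ with received := insert (j, m) σ.received } ∅
  /-- `timer_newleader` has expired at the leader: send the proposal to all -/
  | propose (σ : PState P.n Value Hash) (d : ℝ) (x : Value) (C : Cert P.n Hash)
      (hd : σ.newLeaderTimer = some d) (hc : d ≤ c) (hl : i = P.leader σ.currView)
      (hx : P.ChoosesProposal i σ σ.currView x C) :
      Step i c .propose σ { σ with newLeaderTimer := none } {.propose σ.currView x C}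
  /-- a safe proposal for the current view has been received -/
  | vote (σ : PState P.n Value Hash) (j : Fin P.n) (x : Value) (C : Cert P.n Hash)
      (hpos : 0 < σ.currView)
      (hr : (j, .propose σ.currView x C) ∈ σ.received) (hv : σ.voted = false)
      (hs : P.SafeProposal σ j σ.currView x C) :
      Step i c .vote σ { σ with currVal := some x, voted := true }
        {.prepared σ.currView (P.hash x)}
  /-- a quorum of matching `PREPARED` messages has been received (executed once per view) -/
  | prepare (σ : PState P.n Value Hash) (Q : Finset (Fin P.n)) (x : Value)
      (hQ : Q.card = 2 * P.f + 1)
      (hr : ∀ j ∈ Q, (j, .prepared σ.currView (P.hash x)) ∈ σ.received)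
      (hv : σ.voted = true) (hx : σ.currVal = some x) (hfirst : σ.lockedView ≠ σ.currView) :
      Step i c .prepare σ
        { σ with
          preparedVal := some x
          preparedView := σ.currView
          lockedView := σ.currView
          cert := {s | s.1 ∈ Q ∧ s.2 = (σ.currView, P.hash x)} }
        {.committed σ.currView (P.hash x)}
  /-- a quorum of matching `COMMITTED` messages has been received (executed once) -/
  | decide (σ : PState P.n Value Hash) (Q : Finset (Fin P.n)) (x : Value)
      (hpos : 0 < σ.currView) (hQ : Q.card = 2 * P.f + 1)
      (hr : ∀ j ∈ Q, (j, .committed σ.currView (P.hash x)) ∈ σ.received)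
      (hl : σ.lockedView = σ.currView) (hx : σ.currVal = some x) (hfirst : σ.decided = none) :
      Step i c (.decide x) σ { σ with decided := some x } ∅

/-- The initial states (with an arbitrary phase of the periodic retransmission), when the local
clock reads `c`. -/
def Initial (c : ℝ) (σ : PState P.n Value Hash) : Prop :=
  (∀ j, σ.maxViews j = 0) ∧ σ.view = 0 ∧ σ.viewPlus = 0 ∧ σ.viewTimer = none ∧
    σ.retransmitAt ≤ c + P.ρ ∧ σ.currView = 0 ∧ σ.voted = false ∧ σ.currVal = none ∧
    σ.preparedVal = none ∧ σ.preparedView = 0 ∧ σ.lockedView = 0 ∧ σ.cert = ∅ ∧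
    σ.newLeaderTimer = none ∧ σ.received = ∅ ∧ σ.decided = none

/-- Standing assumptions on the parameters and the environment: `F` is non-decreasing with
`F(0) = 0`, at most `f` processes are faulty, correct processes propose valid values, and the clocks
of correct processes advance arbitrarily before `GST` and at the rate of real time afterwards. -/
structure Admissible (N : Env P.n) : Prop where
  F_zero : P.F 0 = 0
  F_mono : Monotone P.F
  ρ_pos : 0 < P.ρ
  δ_pos : 0 < N.δ
  GST_nonneg : 0 ≤ N.GST
  faulty_le : (N.correct)ᶜ.card ≤ P.f
  myval_valid : ∀ i ∈ N.correct, P.valid (P.myval i)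
  clock_mono : ∀ i ∈ N.correct, Monotone (N.clock i)
  clock_rate : ∀ i ∈ N.correct, ∀ t t', N.GST ≤ t → t ≤ t' →
    N.clock i t' - N.clock i t = t' - t

end Protocol

/-! ### Executions -/

/-- A sequence of steps of the correct processes. The `k`-th step is taken at time `time (k + 1)` by
process `actor k`; it leads from `state k` to `state (k + 1)` and sends the messages `sent k`. -/
structure Trace {Value Hash : Type*} (P : Protocol Value Hash) where
  time : ℕ → ℝ
  state : ℕ → Fin P.n → PState P.n Value Hash
  actor : ℕ → Fin P.n
  action : ℕ → Action P.n Value Hash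
  sent : ℕ → Set (Msg P.n Value Hash)
  /-- the time at which each correct process calls `start()` -/
  startTime : Fin P.n → ℝ

namespace Trace

variable {Value Hash : Type*} {P : Protocol Value Hash} (e : Trace P)

/-- Process `i` sends `m` at the `k`-th step. -/
def Sends (k : ℕ) (i : Fin P.n) (m : Msg P.n Value Hash) : Prop :=
  e.actor k = i ∧ m ∈ e.sent k

/-- Process `i` receives `m` from `j` at the `k`-th step. -/
def Receives (k : ℕ) (i j : Fin P.n) (m : Msg P.n Value Hash) : Prop :=
  e.actor k = i ∧ e.action k = .receive j m

/-- The value `x` occurs in a message sent or received by a correct process. -/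
def Occurs (x : Value) : Prop :=
  ∃ k m, (m ∈ e.sent k ∨ ∃ j, e.action k = .receive j m) ∧ m.Carries x

/-- Executions of two-phase HotStuff over FastSync under partial synchrony. Faulty processes
are represented only by the messages that correct processes receive from them. -/
structure IsExecution (N : Env P.n) : Prop where
  time_zero : e.time 0 = 0
  time_mono : Monotone e.time
  /-- only finitely many steps are taken in bounded time -/
  time_unbounded : Filter.Tendsto e.time Filter.atTop Filter.atTop
  init : ∀ i ∈ N.correct, P.Initial (N.clock i 0) (e.state 0 i)
  actor_correct : ∀ k, e.actor k ∈ N.correct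
  step : ∀ k, P.Step (e.actor k) (N.clock (e.actor k) (e.time (k + 1))) (e.action k)
    (e.state k (e.actor k)) (e.state (k + 1) (e.actor k)) (e.sent k)
  frame : ∀ k, ∀ j ≠ e.actor k, e.state (k + 1) j = e.state k j
  /-- local processing takes no time: time does not pass while a correct process can take an
  internal step (such as handling the expiry of a timer) -/
  urgent : ∀ k t, e.time k ≤ t → t < e.time (k + 1) → ∀ i ∈ N.correct, ∀ a σ' out,
    a.Internal → ¬ P.Step i (N.clock i t) a (e.state k i) σ' out
  /-- every correct process calls `start()` ... -/
  start_called : ∀ i ∈ N.correct, ∃ k, e.actor k = i ∧ e.action k = .start ∧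
    e.time (k + 1) = e.startTime i
  /-- ... exactly once -/
  start_once : ∀ k k', e.actor k = e.actor k' → e.action k = .start → e.action k' = .start → k = k'
  /-- messages attributed to correct processes have been sent by them -/
  authentic : ∀ k i j m, j ∈ N.correct → e.Receives k i j m → ∃ k' < k, e.Sends k' j m
  /-- signatures of correct processes inside certificates are not forged -/
  unforgeable : ∀ k i j m l v h, e.Receives k i j m → (l, v, h) ∈ m.cert → l ∈ N.correct →
    ∃ k' < k, e.Sends k' l (.prepared v h)
  /-- messages between correct processes sent after `GST` arrive within `δ`; those sent before
  `GST` may be lost or arrive at any later time -/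
  delivery : ∀ k i j m, j ∈ N.correct → e.Sends k i m → P.SentTo m j → N.GST ≤ e.time (k + 1) →
    ∃ k' > k, e.Receives k' j i m ∧ e.time (k' + 1) ≤ e.time (k + 1) + N.δ
  /-- messages to oneself are never lost and arrive at once -/
  self_delivery : ∀ k i m, e.Sends k i m → P.SentTo m i →
    ∃ k' > k, e.Receives k' i i m ∧ e.time (k' + 1) = e.time (k + 1)
  /-- the hash function is collision-resistant: no hash collision turns up -/
  collision_free : ∀ x y, e.Occurs x → e.Occurs y → P.hash x = P.hash y → x = y

/-- Process `i` enters view `v` at or before time `t`. (The variable `currView` changes exactly when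
a view is entered.) -/
def EnteredBy (i : Fin P.n) (v : ℕ) (t : ℝ) : Prop :=
  ∃ k, e.time (k + 1) ≤ t ∧ (e.state k i).currView ≠ v ∧ (e.state (k + 1) i).currView = v

/-- Local view: the latest (equivalently, as views only grow, the highest) view entered by `i` at
or before `t`, or `0` if there is none. -/
noncomputable def LV (i : Fin P.n) (t : ℝ) : ℕ := sSup {v | e.EnteredBy i v t}

/-- Global view: the maximum of the local views of correct processes. -/
noncomputable def GV (N : Env P.n) (t : ℝ) : ℕ := N.correct.sup fun i => e.LV i t

/-- The earliest time by which `m` correct processes have called `start()`. -/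
noncomputable def tFirst (N : Env P.n) (m : ℕ) : ℝ :=
  sInf {t | m ≤ {i | i ∈ N.correct ∧ e.startTime i ≤ t}.ncard}

/-- Process `i` decides (on some value) no later than time `t`. -/
def DecidesBy (i : Fin P.n) (t : ℝ) : Prop :=
  ∃ k x, e.actor k = i ∧ e.action k = .decide x ∧ e.time (k + 1) ≤ t

end Trace

end TwoPhaseHotStuff

namespace TwoPhaseHotStuff

/-! ### Order statistics -/

/-! The theorem combines a statement on how the synchronizer moves through the views with a
statement on what happens inside one good view. Synchronizer. Every correct process retransmits once
in `[GST, GST + ρ]`, so a wish made by a time `t ≥ GST + ρ`, however early, has effect at all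
correct processes by `t + δ` (`resent_of_wished`). If some correct process has `view ≥ w` by such a
time `t`, then `f + 1` correct processes have wished for `w`; their wishes raise every `view⁺`
within `δ`, hence all correct processes wish for `w`, and after another `δ` all of them have `view ≥
w` (`le_view_of_wished`). Once all have reached `w`, each of them wishes for `w + 1` within `F w`,
and a further `δ` takes all of them there (`le_view_succ`). Conversely, wishes by correct processes
for views above `w` can be traced back to a correct process whose timer ran for the full `F w` in
view `w` (`exists_enters_of_wish`). So if `w` is first entered at `t₀ > GST + ρ`, all correct
processes are in `w` throughout `[t₀ + 2δ, t₀ + F w)` (`exists_first_entry`). A good view. Let the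
leader of this `w` be correct. It enters in `[t₀, t₀ + 2δ]` and waits `F_p w > 3δ`, hence proposes
after `t₀ + 3δ`, when it has the `NEWLEADER` messages of all correct processes. Its proposal,
prepared in the highest view reported, passes everybody's lock check: a strictly higher certificate
overrides the lock, and two certificates of equal view certify the same value, by quorum
intersection (`safeProposal`). Three message delays later everybody decides, by `t₀ + 2δ + F_p w +
3δ` at the latest. This is still before `t₀ + F w`, which is what `F - F_p > 5δ` is for
(`Stable.decidesBy`). Deadline. Catching up once costs `2δ` and passing view `k` costs `F k + δ`,
which bounds the time to reach any view `w ≥ v` (`le_view_of_sum`). One of the views `v, …, v + f`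
has a correct leader; the worst case is the last of them. -/

theorem le_highest_iff {n q w : ℕ} {mv : Fin n → ℕ} (hq : 0 < q) (hw : 0 < w) :
    w ≤ highest q mv ↔ q ≤ (Finset.univ.filter fun j => w ≤ mv j).card := by
  unfold highest
  rw [Finset.le_sup_iff hw]
  constructor
  · rintro ⟨k, -, hk⟩
    split_ifs at hk with h
    · refine h.trans (Finset.card_le_card fun j hj => ?_)
      simp only [Finset.mem_filter, Finset.mem_univ, true_and] at hj ⊢
      exact hk.trans hj
    · omega
  · intro h
    -- The least among the entries that are at least `w` is the witness: all entries that count for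
    -- `w` also count for it.
    obtain ⟨k, hk, hmin⟩ := Finset.exists_min_image (Finset.univ.filter fun j => w ≤ mv j) mv
      (Finset.card_pos.mp (hq.trans_le h))
    refine ⟨k, Finset.mem_univ k, ?_⟩
    rw [if_pos]
    · exact (Finset.mem_filter.mp hk).2
    · refine h.trans (Finset.card_le_card fun j hj => ?_)
      simpa using hmin j hj

theorem highest_le_highest {n q q' : ℕ} {mv mv' : Fin n → ℕ} (hq' : 0 < q') (hqq : q' ≤ q)
    (h : ∀ j, mv j ≤ mv' j) : highest q mv ≤ highest q' mv' := by
  rcases Nat.eq_zero_or_pos (highest q mv) with h0 | h0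
  · omega
  · rw [le_highest_iff hq' h0]
    refine hqq.trans (((le_highest_iff (hq'.trans_le hqq) h0).1 le_rfl).trans
      (Finset.card_le_card fun j hj => ?_))
    simp only [Finset.mem_filter, Finset.mem_univ, true_and] at hj ⊢
    exact hj.trans (h j)

theorem highest_of_eq_zero {n q : ℕ} {mv : Fin n → ℕ} (h : ∀ j, mv j = 0) : highest q mv = 0 := by
  simp [highest, h]

/-! ### Quorums -/

namespace Protocol.Admissible

variable {Value Hash : Type*} {P : Protocol Value Hash} {N : Env P.n}

theorem exists_mem_correct (hPN : P.Admissible N) {A : Finset (Fin P.n)}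
    (hA : P.f + 1 ≤ A.card) : ∃ j ∈ A, j ∈ N.correct := by
  by_contra! h
  have : A ⊆ (N.correct)ᶜ := fun j hj => Finset.mem_compl.2 (h j hj)
  have := Finset.card_le_card this
  have := hPN.faulty_le
  omega

theorem le_card_correct (hPN : P.Admissible N) : 2 * P.f + 1 ≤ N.correct.card := by
  have h1 := Finset.card_add_card_compl N.correct
  have h2 := hPN.faulty_le
  rw [Fintype.card_fin] at h1
  have : P.n = 3 * P.f + 1 := rfl
  omega

theorem exists_quorum (hPN : P.Admissible N) :
    ∃ Q : Finset (Fin P.n), Q ⊆ N.correct ∧ Q.card = 2 * P.f + 1 :=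
  Finset.exists_subset_card_eq hPN.le_card_correct

theorem le_card_filter_correct (hPN : P.Admissible N) {A : Finset (Fin P.n)}
    (hA : 2 * P.f + 1 ≤ A.card) : P.f + 1 ≤ (A.filter (· ∈ N.correct)).card := by
  have h1 := Finset.card_filter_add_card_filter_not (s := A) (· ∈ N.correct)
  have h2 : (A.filter fun j => ¬ j ∈ N.correct).card ≤ (N.correct)ᶜ.card :=
    Finset.card_le_card fun j hj => Finset.mem_compl.2 (Finset.mem_filter.1 hj).2
  have h3 := hPN.faulty_le
  omega

/-- Two quorums share at least `2(2f + 1) - (3f + 1) = f + 1` processes, one more than can be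
faulty. -/
theorem exists_mem_inter (hPN : P.Admissible N) {A B : Finset (Fin P.n)}
    (hA : A.card = 2 * P.f + 1) (hB : B.card = 2 * P.f + 1) :
    ∃ j ∈ A, j ∈ B ∧ j ∈ N.correct := by
  have h1 := Finset.card_union_add_card_inter A B
  have h2 := Finset.card_le_univ (A ∪ B)
  rw [Fintype.card_fin] at h2
  have h3 : P.n = 3 * P.f + 1 := rfl
  obtain ⟨j, hj, hjc⟩ := hPN.exists_mem_correct (A := A ∩ B) (by omega)
  exact ⟨j, (Finset.mem_inter.1 hj).1, (Finset.mem_inter.1 hj).2, hjc⟩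

theorem F_nonneg (hPN : P.Admissible N) (k : ℕ) : 0 ≤ P.F k :=
  hPN.F_zero ▸ hPN.F_mono (Nat.zero_le k)

theorem clock_add (hPN : P.Admissible N) {i : Fin P.n} (hi : i ∈ N.correct) {t d : ℝ}
    (ht : N.GST ≤ t) (hd : 0 ≤ d) : N.clock i (t + d) = N.clock i t + d := by
  have := hPN.clock_rate i hi t (t + d) ht (by linarith)
  linarith

/-- After `GST`, local time differences bound real time differences from below. -/
theorem le_of_clock_le (hPN : P.Admissible N) {i : Fin P.n} (hi : i ∈ N.correct) {t t' d : ℝ}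
    (ht : N.GST ≤ t) (htt : t ≤ t') (h : N.clock i t + d ≤ N.clock i t') : t + d ≤ t' := by
  have := hPN.clock_rate i hi t t' ht htt
  linarith

/-- Among `f + 1` consecutive views, one has a correct leader. -/
theorem exists_correct_leader (hPN : P.Admissible N) {v : ℕ} (hv : 1 ≤ v) :
    ∃ k ∈ Finset.Icc v (v + P.f), P.leader k ∈ N.correct := by
  -- The window is shorter than `n`, so no leader repeats in it. Views start at `1`: with truncated
  -- subtraction, view `0` would have the same leader as view `1`.
  have hinj : Set.InjOn P.leader (Finset.Icc v (v + P.f) : Finset ℕ) := by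
    intro a ha b hb hab
    simp only [Finset.coe_Icc, Set.mem_Icc] at ha hb
    have h : (a - 1) ≡ (b - 1) [MOD P.n] := congrArg Fin.val hab
    have hn : P.n = 3 * P.f + 1 := rfl
    rcases le_total a b with hle | hle
    · have h' := (Nat.modEq_iff_dvd' (by omega)).1 h
      have := Nat.eq_zero_of_dvd_of_lt h' (by omega)
      omega
    · have h' := (Nat.modEq_iff_dvd' (by omega)).1 h.symm
      have := Nat.eq_zero_of_dvd_of_lt h' (by omega)
      omega
  have hcard := Finset.card_image_of_injOn hinj
  rw [Nat.card_Icc] at hcard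
  obtain ⟨j, hj, hjc⟩ := hPN.exists_mem_correct
    (A := (Finset.Icc v (v + P.f)).image P.leader) (by omega)
  obtain ⟨k, hk, rfl⟩ := Finset.mem_image.1 hj
  exact ⟨k, hk, hjc⟩

end Protocol.Admissible

/-! ### Executions as functions of time -/

namespace Trace

variable {Value Hash : Type*} {P : Protocol Value Hash} {N : Env P.n} {e : Trace P}

/-- The number of steps taken at or before time `t`. -/
noncomputable def stepsBy (e : Trace P) (t : ℝ) : ℕ := sInf {k | t < e.time (k + 1)}

namespace IsExecution

theorem lt_time_stepsBy (he : e.IsExecution N) (t : ℝ) : t < e.time (e.stepsBy t + 1) := by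
  have hne : {k | t < e.time (k + 1)}.Nonempty := by
    obtain ⟨k, hk⟩ := (he.time_unbounded.eventually_gt_atTop t).exists
    exact ⟨k, hk.trans_le (he.time_mono (Nat.le_succ k))⟩
  exact Nat.sInf_mem hne

/-- The dictionary between real time and step indices. Step `k` is taken at `time (k + 1)`, and
`state (stepsBy t)` is the state at time `t` after all steps taken at `t` itself. -/
theorem lt_stepsBy_iff (he : e.IsExecution N) {k : ℕ} {t : ℝ} :
    k < e.stepsBy t ↔ e.time (k + 1) ≤ t := by
  constructor
  · intro h
    exact not_lt.1 (Nat.notMem_of_lt_sInf h)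
  · intro h
    have := he.time_mono.reflect_lt (h.trans_lt (he.lt_time_stepsBy t))
    omega

theorem time_stepsBy_le (he : e.IsExecution N) {t : ℝ} (ht : 0 ≤ t) :
    e.time (e.stepsBy t) ≤ t := by
  rcases Nat.eq_zero_or_pos (e.stepsBy t) with h | h
  · rw [h, he.time_zero]; exact ht
  · obtain ⟨k, hk⟩ := Nat.exists_eq_succ_of_ne_zero h.ne'
    rw [hk]
    exact he.lt_stepsBy_iff.1 (by omega)

theorem stepsBy_mono (he : e.IsExecution N) {t t' : ℝ} (h : t ≤ t') :
    e.stepsBy t ≤ e.stepsBy t' := by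
  by_contra! hlt
  have := he.lt_stepsBy_iff.1 hlt
  exact absurd (he.lt_time_stepsBy t') (not_lt.2 (this.trans h))

/-- The form in which urgency is used: once all steps up to time `t` have been taken, no internal
step is enabled. Progress is always derived by contradiction from this, since a handler that had not
been executed would still be enabled. -/
theorem not_step_stepsBy (he : e.IsExecution N) {t : ℝ} (ht : 0 ≤ t) {i : Fin P.n}
    (hi : i ∈ N.correct) {a : Action P.n Value Hash} (ha : a.Internal)
    {σ' : PState P.n Value Hash} {out : Set (Msg P.n Value Hash)} :
    ¬ P.Step i (N.clock i t) a (e.state (e.stepsBy t) i) σ' out :=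
  he.urgent _ t (he.time_stepsBy_le ht) (he.lt_time_stepsBy t) i hi a σ' out ha

/-- Induction along the states of a correct process. -/
theorem induct (he : e.IsExecution N) {i : Fin P.n} (hi : i ∈ N.correct)
    {Φ : ℕ → PState P.n Value Hash → Prop}
    (init : ∀ σ, P.Initial (N.clock i 0) σ → Φ 0 σ)
    (frame : ∀ k σ, e.state k i = σ → e.actor k ≠ i → Φ k σ → Φ (k + 1) σ)
    (step : ∀ k a σ σ' out, e.actor k = i → e.action k = a → e.state k i = σ →
      e.state (k + 1) i = σ' → e.sent k = out →
      P.Step i (N.clock i (e.time (k + 1))) a σ σ' out → Φ k σ → Φ (k + 1) σ') (k : ℕ) :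
    Φ k (e.state k i) := by
  induction k with
  | zero => exact init _ (he.init i hi)
  | succ k ih =>
    by_cases hk : e.actor k = i
    · have := he.step k
      rw [hk] at this
      exact step k _ _ _ _ hk rfl rfl rfl rfl this ih
    · rw [he.frame k i (Ne.symm hk)]
      exact frame k _ rfl hk ih

theorem step_of_actor (he : e.IsExecution N) {k : ℕ} {i : Fin P.n} (h : e.actor k = i) :
    P.Step i (N.clock i (e.time (k + 1))) (e.action k) (e.state k i) (e.state (k + 1) i)
      (e.sent k) := h ▸ he.step k

end IsExecution
end Trace
/-! ### The synchronizer: single steps -/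

section Steps

variable {Value Hash : Type*} {P : Protocol Value Hash}

/-- State invariant of the synchronizer. -/
structure PState.Synced (P : Protocol Value Hash) (σ : PState P.n Value Hash) : Prop where
  view_eq : σ.view = highest (2 * P.f + 1) σ.maxViews
  viewPlus_eq : σ.viewPlus = highest (P.f + 1) σ.maxViews
  currView_le : σ.currView ≤ σ.view
  view_pos : σ.viewTimer.isSome → 0 < σ.view

theorem PState.Synced.view_le {σ : PState P.n Value Hash} (h : σ.Synced P) :
    σ.view ≤ σ.viewPlus := by
  rw [h.view_eq, h.viewPlus_eq]
  exact highest_le_highest (by omega) (by omega) fun _ => le_rfl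

namespace Protocol

theorem maxViews_le_recordWish (σ : PState P.n Value Hash) (j l : Fin P.n) (v : ℕ) :
    σ.maxViews l ≤ (P.recordWish j v σ).maxViews l := by
  simp only [recordWish, Function.update_apply]
  split_ifs with h
  · rw [h]; exact le_max_left _ _
  · exact le_rfl

theorem view_le_recordWish {σ : PState P.n Value Hash} (h : σ.Synced P) (j : Fin P.n) (v : ℕ) :
    σ.view ≤ (P.recordWish j v σ).view := by
  rw [h.view_eq]
  exact highest_le_highest (by omega) le_rfl (maxViews_le_recordWish σ j · v)

theorem viewPlus_le_recordWish {σ : PState P.n Value Hash} (h : σ.Synced P) (j : Fin P.n)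
    (v : ℕ) : σ.viewPlus ≤ (P.recordWish j v σ).viewPlus := by
  rw [h.viewPlus_eq]
  exact highest_le_highest (by omega) le_rfl (maxViews_le_recordWish σ j · v)

theorem Initial.synced {c : ℝ} {σ : PState P.n Value Hash} (h : P.Initial c σ) :
    σ.Synced P := by
  obtain ⟨h1, h2, h3, h4, -, h6, -⟩ := h
  exact ⟨by rw [h2, highest_of_eq_zero h1], by rw [h3, highest_of_eq_zero h1], by omega,
    by simp [h4]⟩

namespace Step

variable {i : Fin P.n} {c : ℝ} {a : Action P.n Value Hash} {σ σ' : PState P.n Value Hash}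
  {out : Set (Msg P.n Value Hash)}

theorem synced (h : P.Step i c a σ σ' out) (hs : σ.Synced P) : σ'.Synced P := by
  cases h with
  | start | retransmit | receiveOther | propose | vote | prepare | decide =>
    exact ⟨hs.view_eq, hs.viewPlus_eq, hs.currView_le, hs.view_pos⟩
  | viewTimeout => exact ⟨hs.view_eq, hs.viewPlus_eq, hs.currView_le, by simp⟩
  | receiveWish _ _ j v hσ₁ hE =>
    have := view_le_recordWish hs j v
    subst hσ₁
    exact ⟨rfl, rfl, hs.currView_le.trans this, fun ht => (hs.view_pos ht).trans_le this⟩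
  | enterView _ σ₁ j v hσ₁ hE =>
    have h2 := hE.2
    subst hσ₁
    exact ⟨rfl, rfl, le_rfl, fun _ => (Nat.zero_le _).trans_lt h2⟩

theorem mono (h : P.Step i c a σ σ' out) (hs : σ.Synced P) :
    (∀ j, σ.maxViews j ≤ σ'.maxViews j) ∧ σ.view ≤ σ'.view ∧ σ.viewPlus ≤ σ'.viewPlus ∧
      σ.currView ≤ σ'.currView := by
  cases h with
  | start | retransmit | receiveOther | propose | vote | prepare | decide | viewTimeout =>
    exact ⟨fun _ => le_rfl, le_rfl, le_rfl, le_rfl⟩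
  | receiveWish _ _ j v hσ₁ hE =>
    subst hσ₁
    exact ⟨(maxViews_le_recordWish σ j · v), view_le_recordWish hs j v,
      viewPlus_le_recordWish hs j v, le_rfl⟩
  | enterView _ σ₁ j v hσ₁ hE =>
    have h2 := hE.2
    subst hσ₁
    exact ⟨(maxViews_le_recordWish σ j · v), view_le_recordWish hs j v,
      viewPlus_le_recordWish hs j v, hs.currView_le.trans h2.le⟩

theorem received_subset (h : P.Step i c a σ σ' out) : σ.received ⊆ σ'.received := by
  cases h with
  | start | retransmit | propose | vote | prepare | decide | viewTimeout => exact subset_rfl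
  | receiveOther => exact Set.subset_insert _ _
  | receiveWish _ _ j v hσ₁ hE => subst hσ₁; exact subset_rfl
  | enterView _ σ₁ j v hσ₁ hE => subst hσ₁; exact subset_rfl

end Step
end Protocol

/-- The view in the `WISH` message sent upon timeout or retransmission. -/
def PState.wishView {n : ℕ} (σ : PState n Value Hash) : ℕ :=
  if σ.viewTimer.isSome then σ.viewPlus else max (σ.view + 1) σ.viewPlus

namespace Protocol.Step

variable {i : Fin P.n} {c : ℝ} {a : Action P.n Value Hash} {σ σ' : PState P.n Value Hash}
  {out : Set (Msg P.n Value Hash)}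

/-- The value passes from `view⁺` to `max (view + 1) view⁺` when the timer expires. It passes back
only upon view entry, where the new `view⁺` equals the new `view`, hence is at least the old `view +
1`. Together with `le_wishView`, this shows that a retransmitted wish is never lower than an earlier
one. -/
theorem wishView_mono (h : P.Step i c a σ σ' out) (hs : σ.Synced P) :
    σ.wishView ≤ σ'.wishView := by
  have hle := hs.view_le
  have hm := h.mono hs
  have hle' := (h.synced hs).view_le
  cases h with
  | start | retransmit | receiveOther | propose | vote | prepare | decide => exact le_rfl
  | viewTimeout => simp only [PState.wishView]; split_ifs <;> simp_all
  | receiveWish _ _ j v hσ₁ hE =>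
    have ht : σ'.viewTimer = σ.viewTimer := by subst hσ₁; rfl
    simp only [PState.wishView, ht]
    split_ifs <;> omega
  | enterView _ σ₁ j v hσ₁ hE =>
    obtain ⟨h1, h2⟩ := hE
    simp only [PState.wishView, Protocol.newView] at *
    split_ifs <;> simp_all

theorem le_wishView (h : P.Step i c a σ σ' out) (hs : σ.Synced P) {w : ℕ}
    (hw : .wish w ∈ out) : w ≤ σ'.wishView := by
  have hle := hs.view_le
  have hle' := (h.synced hs).view_le
  have hp := (h.synced hs).view_pos
  cases h with
  | start =>
    split_ifs at hw
    · simp only [Set.mem_singleton_iff, Msg.wish.injEq] at hw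
      unfold PState.wishView
      split_ifs with ht
      · have := hp ht; omega
      · omega
    · simp at hw
  | receiveOther | propose | vote | prepare | decide => simp at hw
  | retransmit =>
    simp only [PState.wishView]
    split_ifs at hw ⊢ <;> simp_all
  | viewTimeout =>
    simp only [PState.wishView]
    simp_all
  | receiveWish _ _ j v hσ₁ hE =>
    simp only [PState.wishView]
    split_ifs at hw ⊢ <;> simp_all
  | enterView _ σ₁ j v hσ₁ hE =>
    simp only [PState.wishView, Protocol.newView]
    split_ifs at hw ⊢ <;> simp_all

end Protocol.Step
end Steps

/-! ### The synchronizer: executions -/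

namespace Trace

variable {Value Hash : Type*} {P : Protocol Value Hash} {N : Env P.n} {e : Trace P}

/-- Process `i` sends `WISH(w')` for some `w' ≥ w` before step `k`. -/
def Wished (e : Trace P) (i : Fin P.n) (w k : ℕ) : Prop :=
  ∃ s < k, ∃ w' ≥ w, e.Sends s i (.wish w')

theorem Wished.mono {i : Fin P.n} {w w' k k' : ℕ} (h : e.Wished i w k) (hw : w' ≤ w)
    (hk : k ≤ k') : e.Wished i w' k' := by
  obtain ⟨s, hs, u, hu, h⟩ := h
  exact ⟨s, hs.trans_le hk, u, hw.trans hu, h⟩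

/-- Process `i` enters view `w` at the `r`-th step. -/
def Enters (e : Trace P) (r : ℕ) (i : Fin P.n) (w : ℕ) : Prop :=
  e.actor r = i ∧ (e.state r i).currView < w ∧ (e.state (r + 1) i).currView = w

namespace IsExecution

theorem synced (he : e.IsExecution N) {i : Fin P.n} (hi : i ∈ N.correct) (k : ℕ) :
    (e.state k i).Synced P :=
  he.induct hi (Φ := fun _ σ => σ.Synced P) (fun _ h => h.synced) (fun _ _ _ _ h => h)
    (fun _ _ _ _ _ _ _ _ _ _ h hs => h.synced hs) k

/-- A quantity that does not decrease in any step does not decrease along an execution. -/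
theorem mono_of_step (he : e.IsExecution N) {i : Fin P.n} (hi : i ∈ N.correct) {α : Type*}
    [Preorder α] (g : PState P.n Value Hash → α)
    (hg : ∀ c a σ σ' out, P.Step i c a σ σ' out → σ.Synced P → g σ ≤ g σ') :
    Monotone fun k => g (e.state k i) := by
  refine monotone_nat_of_le_succ fun k => ?_
  by_cases hk : e.actor k = i
  · exact hg _ _ _ _ _ (he.step_of_actor hk) (he.synced hi k)
  · simp only [he.frame k i (Ne.symm hk), le_refl]

theorem maxViews_mono (he : e.IsExecution N) {i : Fin P.n} (hi : i ∈ N.correct) (j : Fin P.n) :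
    Monotone fun k => (e.state k i).maxViews j :=
  he.mono_of_step hi (fun σ => σ.maxViews j) fun _ _ _ _ _ h hs => (h.mono hs).1 j

theorem view_mono (he : e.IsExecution N) {i : Fin P.n} (hi : i ∈ N.correct) :
    Monotone fun k => (e.state k i).view :=
  he.mono_of_step hi (fun σ => σ.view) fun _ _ _ _ _ h hs => (h.mono hs).2.1

theorem viewPlus_mono (he : e.IsExecution N) {i : Fin P.n} (hi : i ∈ N.correct) :
    Monotone fun k => (e.state k i).viewPlus :=
  he.mono_of_step hi (fun σ => σ.viewPlus) fun _ _ _ _ _ h hs => (h.mono hs).2.2.1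

theorem currView_mono (he : e.IsExecution N) {i : Fin P.n} (hi : i ∈ N.correct) :
    Monotone fun k => (e.state k i).currView :=
  he.mono_of_step hi (fun σ => σ.currView) fun _ _ _ _ _ h hs => (h.mono hs).2.2.2

theorem wishView_mono (he : e.IsExecution N) {i : Fin P.n} (hi : i ∈ N.correct) :
    Monotone fun k => (e.state k i).wishView :=
  he.mono_of_step hi PState.wishView fun _ _ _ _ _ h hs => h.wishView_mono hs

theorem received_mono (he : e.IsExecution N) {i : Fin P.n} (hi : i ∈ N.correct) :
    Monotone fun k => (e.state k i).received :=
  he.mono_of_step hi (fun σ => σ.received) fun _ _ _ _ _ h _ => h.received_subset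

theorem Enters.lt_of_le (he : e.IsExecution N) {i : Fin P.n} (hi : i ∈ N.correct) {r k w : ℕ}
    (h : e.Enters r i w) (hk : w ≤ (e.state k i).currView) : r < k := by
  by_contra! hle
  have := he.currView_mono hi hle
  have := h.2.1
  simp only at *
  omega

theorem Enters.unique (he : e.IsExecution N) {i : Fin P.n} (hi : i ∈ N.correct) {r r' w : ℕ}
    (h : e.Enters r i w) (h' : e.Enters r' i w) : r = r' := by
  have h1 := Enters.lt_of_le he hi h h'.2.2.ge
  have h2 := Enters.lt_of_le he hi h' h.2.2.ge
  omega

/-- Receipt of a `WISH` message is recorded. -/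
theorem le_maxViews_of_receives (he : e.IsExecution N) {i j : Fin P.n} {k w : ℕ}
    (h : e.Receives k i j (.wish w)) : w ≤ (e.state (k + 1) i).maxViews j := by
  have hstep := he.step_of_actor h.1
  rw [h.2] at hstep
  generalize e.state k i = σ at hstep
  generalize e.state (k + 1) i = σ' at hstep
  generalize e.sent k = out at hstep
  cases hstep with
  | receiveWish _ _ _ _ hσ₁ hE => subst hσ₁; simp [Protocol.recordWish]
  | enterView _ σ₁ _ _ hσ₁ hE => subst hσ₁; simp [Protocol.recordWish, Protocol.newView]
  | receiveOther _ _ _ hm => exact absurd rfl (hm w)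

/-- Entries of `maxViews` of correct processes come from messages they sent. -/
theorem wished_of_le_maxViews (he : e.IsExecution N) {i j : Fin P.n} (hi : i ∈ N.correct)
    (hj : j ∈ N.correct) {w : ℕ} (hw : 0 < w) (k : ℕ) :
    w ≤ (e.state k i).maxViews j → e.Wished j w (k - 1) := by
  -- The bound `k - 1` records that the wish precedes the step in which it is received. The
  -- induction in `exists_enters_of_wish` needs this strictness.
  refine he.induct hi (Φ := fun k σ => w ≤ σ.maxViews j → e.Wished j w (k - 1)) ?_ ?_ ?_ k
  · intro σ hσ h
    rw [hσ.1 j] at h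
    omega
  · intro k σ _ _ h hle
    exact (h hle).mono le_rfl (by omega)
  · intro k a σ σ' out hact ha _ _ _ hstep h hle
    have key : ∀ l v, a = .receive l (.wish v) → w ≤ (P.recordWish l v σ).maxViews j →
        e.Wished j w k := by
      intro l v hal hle
      simp only [Protocol.recordWish, Function.update_apply] at hle
      split_ifs at hle with hjl
      · rcases le_max_iff.1 hle with hle | hle
        · exact (h (hjl ▸ hle)).mono le_rfl (by omega)
        · obtain ⟨s, hs, hsend⟩ := he.authentic k i j (.wish v) hj
            ⟨hact, by rw [ha, hal, hjl]⟩
          exact ⟨s, hs, v, hle, hsend⟩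
      · exact (h hle).mono le_rfl (by omega)
    cases hstep with
    | start | retransmit | receiveOther | propose | vote | prepare | decide | viewTimeout =>
      exact (h hle).mono le_rfl (by omega)
    | receiveWish _ _ l v hσ₁ hE => subst hσ₁; exact key l v rfl hle
    | enterView _ σ₁ l v hσ₁ hE => subst hσ₁; exact key l v rfl hle

/-- At least `2f + 1` entries of `max_views` reach `w`; at most `f` of them belong to faulty
processes, and the others reflect wishes really made. For `view⁺`, the same count leaves one correct
process. -/
theorem wished_of_le_view (hPN : P.Admissible N) (he : e.IsExecution N) {i : Fin P.n}
    (hi : i ∈ N.correct) {w k : ℕ} (hw : 0 < w) (h : w ≤ (e.state k i).view) :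
    ∃ A ⊆ N.correct, P.f + 1 ≤ A.card ∧ ∀ j ∈ A, e.Wished j w (k - 1) := by
  rw [(he.synced hi k).view_eq, le_highest_iff (by omega) hw] at h
  refine ⟨_, fun j hj => (Finset.mem_filter.1 hj).2, hPN.le_card_filter_correct h, fun j hj => ?_⟩
  simp only [Finset.mem_filter, Finset.mem_univ, true_and] at hj
  exact he.wished_of_le_maxViews hi hj.2 hw k hj.1

theorem wished_of_le_viewPlus (hPN : P.Admissible N) (he : e.IsExecution N) {i : Fin P.n}
    (hi : i ∈ N.correct) {w k : ℕ} (hw : 0 < w) (h : w ≤ (e.state k i).viewPlus) :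
    ∃ j ∈ N.correct, e.Wished j w (k - 1) := by
  rw [(he.synced hi k).viewPlus_eq, le_highest_iff (by omega) hw] at h
  obtain ⟨j, hj, hjc⟩ := hPN.exists_mem_correct h
  exact ⟨j, hjc, he.wished_of_le_maxViews hi hjc hw k (Finset.mem_filter.1 hj).2⟩

/-- A correct process wishes for its own `view⁺`. -/
theorem wished_viewPlus (he : e.IsExecution N) {i : Fin P.n} (hi : i ∈ N.correct) {w : ℕ}
    (hw : 0 < w) (k : ℕ) : w ≤ (e.state k i).viewPlus → e.Wished i w k := by
  refine he.induct hi (Φ := fun k σ => w ≤ σ.viewPlus → e.Wished i w k) ?_ ?_ ?_ k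
  · intro σ hσ h
    have := hσ.2.2.1
    omega
  · intro k σ _ _ h hle
    exact (h hle).mono le_rfl (by omega)
  · intro k a σ σ' out hact _ _ _ ho hstep h hle
    by_cases hlt : w ≤ σ.viewPlus
    · exact (h hlt).mono le_rfl (by omega)
    suffices hs : .wish σ'.viewPlus ∈ out from
      ⟨k, by omega, _, hle, hact, ho ▸ hs⟩
    cases hstep with
    | start | retransmit | receiveOther | propose | vote | prepare | decide | viewTimeout =>
      exact absurd hle hlt
    | receiveWish _ _ l v hσ₁ hE => rw [if_pos (by omega)]; rfl
    | enterView _ σ₁ l v hσ₁ hE =>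
      have : σ.viewPlus < σ₁.viewPlus := (not_le.1 hlt).trans_le hle
      rw [if_pos this]; exact Or.inr rfl

/-- Every correct process retransmits in the interval `[GST, GST + ρ]`. -/
theorem exists_retransmit (hPN : P.Admissible N) (he : e.IsExecution N) {i : Fin P.n}
    (hi : i ∈ N.correct) : ∃ r, e.actor r = i ∧ e.action r = .retransmit ∧
      N.GST ≤ e.time (r + 1) ∧ e.time (r + 1) ≤ N.GST + P.ρ := by
  by_contra! hno
  have hρ := hPN.ρ_pos
  have hG := hPN.GST_nonneg
  -- Without a retransmission in the window, the deadline was set either initially or by a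
  -- retransmission before `GST`. In both cases it is at most the clock reading at `GST` plus `ρ`,
  -- which is the reading at `GST + ρ`; there urgency gives a contradiction.
  have key : ∀ k, k ≤ e.stepsBy (N.GST + P.ρ) →
      (e.state k i).retransmitAt ≤ N.clock i (N.GST + P.ρ) := by
    intro k
    refine he.induct hi (Φ := fun k σ => k ≤ e.stepsBy (N.GST + P.ρ) →
      σ.retransmitAt ≤ N.clock i (N.GST + P.ρ)) ?_ ?_ ?_ k
    · intro σ hσ _
      have h1 := hσ.2.2.2.2.1
      have h2 := hPN.clock_mono i hi hG
      rw [hPN.clock_add hi le_rfl hρ.le]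
      linarith
    · intro k σ _ _ h hk
      exact h (by omega)
    · intro k a σ σ' out hact ha _ _ _ hstep h hk
      have h := h (by omega)
      cases hstep with
      | start | receiveOther | propose | vote | prepare | decide | viewTimeout => exact h
      | receiveWish _ _ l v hσ₁ hE => subst hσ₁; exact h
      | enterView _ σ₁ l v hσ₁ hE => subst hσ₁; exact h
      | retransmit =>
        have hlt : e.time (k + 1) ≤ N.GST := by
          by_contra! hlt
          exact absurd (he.lt_stepsBy_iff.1 hk) (not_le.2 (hno k hact ha hlt.le))
        rw [hPN.clock_add hi le_rfl hρ.le]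
        have := hPN.clock_mono i hi hlt
        simpa using this
  exact he.not_step_stepsBy (by linarith) hi (a := .retransmit) trivial
    (.retransmit _ (key _ le_rfl))

/-- A wish made by time `t ≥ GST + ρ` is sent (again) between `GST` and `t`. -/
theorem resent_of_wished (hPN : P.Admissible N) (he : e.IsExecution N) {i : Fin P.n}
    (hi : i ∈ N.correct) {w : ℕ} (hw : 0 < w) {t : ℝ} (ht : N.GST + P.ρ ≤ t)
    (h : e.Wished i w (e.stepsBy t)) :
    ∃ s, N.GST ≤ e.time (s + 1) ∧ e.time (s + 1) ≤ t ∧ ∃ w' ≥ w, e.Sends s i (.wish w') := by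
  obtain ⟨s, hs, w', hww, hsend⟩ := h
  by_cases hG : N.GST ≤ e.time (s + 1)
  · exact ⟨s, hG, he.lt_stepsBy_iff.1 hs, w', hww, hsend⟩
  obtain ⟨r, hr, hra, hr1, hr2⟩ := he.exists_retransmit hPN hi
  -- The process receives its own wish at once, hence before the retransmission. So `max_views[i] >
  -- 0`, which is the guard for retransmitting while the timer is off.
  obtain ⟨q, hq, hqr, hqt⟩ := he.self_delivery s i _ hsend trivial
  have hqr' : q + 1 ≤ r := by
    have := he.time_mono.reflect_lt (hqt.trans_lt ((not_le.1 hG).trans_le hr1))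
    omega
  have hmv : 0 < (e.state r i).maxViews i :=
    (hw.trans_le hww).trans_le
      ((he.le_maxViews_of_receives hqr).trans (he.maxViews_mono hi i hqr'))
  have hwish : w' ≤ (e.state r i).wishView :=
    ((he.step_of_actor hsend.1).le_wishView (he.synced hi s) hsend.2).trans
      (he.wishView_mono hi (by omega : s + 1 ≤ r))
  refine ⟨r, hr1, hr2.trans ht, _, hww.trans hwish, hr, ?_⟩
  have hstep := he.step_of_actor hr
  rw [hra] at hstep
  generalize e.state (r + 1) i = σ' at hstep
  generalize e.sent r = out at hstep ⊢
  cases hstep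
  unfold PState.wishView
  split_ifs <;> simp

theorem le_maxViews_of_wished (hPN : P.Admissible N) (he : e.IsExecution N) {i j : Fin P.n}
    (hi : i ∈ N.correct) (hj : j ∈ N.correct) {w : ℕ} (hw : 0 < w) {t : ℝ}
    (ht : N.GST + P.ρ ≤ t) (h : e.Wished i w (e.stepsBy t)) :
    w ≤ (e.state (e.stepsBy (t + N.δ)) j).maxViews i := by
  obtain ⟨s, hG, hst, w', hww, hsend⟩ := he.resent_of_wished hPN hi hw ht h
  obtain ⟨q, -, hq, hqt⟩ := he.delivery s i j _ hj hsend trivial hG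
  have : q < e.stepsBy (t + N.δ) := he.lt_stepsBy_iff.2 (by linarith)
  exact hww.trans ((he.le_maxViews_of_receives hq).trans (he.maxViews_mono hj i this))

theorem le_view_of_forall_wished (hPN : P.Admissible N) (he : e.IsExecution N) {w : ℕ}
    (hw : 0 < w) {t : ℝ} (ht : N.GST + P.ρ ≤ t)
    (h : ∀ i ∈ N.correct, e.Wished i w (e.stepsBy t)) {j : Fin P.n} (hj : j ∈ N.correct) :
    w ≤ (e.state (e.stepsBy (t + N.δ)) j).view := by
  rw [(he.synced hj _).view_eq, le_highest_iff (by omega) hw]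
  refine hPN.le_card_correct.trans (Finset.card_le_card fun i hi => ?_)
  simpa using he.le_maxViews_of_wished hPN hi hj hw ht (h i hi)

theorem le_viewPlus_of_wished (hPN : P.Admissible N) (he : e.IsExecution N) {w : ℕ}
    (hw : 0 < w) {t : ℝ} (ht : N.GST + P.ρ ≤ t) {A : Finset (Fin P.n)} (hA : A ⊆ N.correct)
    (hcard : P.f + 1 ≤ A.card) (h : ∀ i ∈ A, e.Wished i w (e.stepsBy t)) {j : Fin P.n}
    (hj : j ∈ N.correct) : w ≤ (e.state (e.stepsBy (t + N.δ)) j).viewPlus := by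
  rw [(he.synced hj _).viewPlus_eq, le_highest_iff (by omega) hw]
  refine hcard.trans (Finset.card_le_card fun i hi => ?_)
  simpa using he.le_maxViews_of_wished hPN (hA hi) hj hw ht (h i hi)

/-- If `f + 1` correct processes wish for `w`, then all correct processes get there. -/
theorem le_view_of_wished (hPN : P.Admissible N) (he : e.IsExecution N) {w : ℕ}
    (hw : 0 < w) {t : ℝ} (ht : N.GST + P.ρ ≤ t) {A : Finset (Fin P.n)} (hA : A ⊆ N.correct)
    (hcard : P.f + 1 ≤ A.card) (h : ∀ i ∈ A, e.Wished i w (e.stepsBy t)) {j : Fin P.n}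
    (hj : j ∈ N.correct) : w ≤ (e.state (e.stepsBy (t + 2 * N.δ)) j).view := by
  have hδ := hPN.δ_pos
  have h2 : t + 2 * N.δ = t + N.δ + N.δ := by ring
  rw [h2]
  -- The first `δ` lifts every `view⁺` to `w`, which makes every correct process wish for `w`; the
  -- second `δ` lifts every `view`.
  exact he.le_view_of_forall_wished hPN hw (by linarith) (fun i hi => he.wished_viewPlus hi hw _
    (he.le_viewPlus_of_wished hPN hw ht hA hcard h hi)) hj

/-- A process with `view = view⁺` has entered this view, and its timer has been started then; if
the timer has expired, the process has wished for the next view. -/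
theorem timer_of_view_eq (hPN : P.Admissible N) (he : e.IsExecution N) {i : Fin P.n}
    (hi : i ∈ N.correct) {w : ℕ} (hw : 0 < w) (k : ℕ) :
    (e.state k i).view = w → (e.state k i).viewPlus = w → (e.state k i).currView = w ∧
      ∃ r < k, e.Enters r i w ∧
        ((e.state k i).viewTimer = some (N.clock i (e.time (r + 1)) + P.F w) ∨
          (e.state k i).viewTimer = none ∧
            N.clock i (e.time (r + 1)) + P.F w ≤ N.clock i (e.time k) ∧
            e.Wished i (w + 1) k) := by
  refine he.induct hi (Φ := fun k σ => σ.view = w → σ.viewPlus = w → σ.currView = w ∧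
      ∃ r < k, e.Enters r i w ∧
        (σ.viewTimer = some (N.clock i (e.time (r + 1)) + P.F w) ∨
          σ.viewTimer = none ∧
            N.clock i (e.time (r + 1)) + P.F w ≤ N.clock i (e.time k) ∧
            e.Wished i (w + 1) k)) ?_ ?_ ?_ k
  · intro σ hσ h
    have := hσ.2.1
    omega
  · intro k σ _ _ h h1 h2
    obtain ⟨h3, r, hr, hE, h4⟩ := h h1 h2
    refine ⟨h3, r, hr.trans (Nat.lt_succ_self k), hE, h4.imp_right fun ⟨h5, h6, h7⟩ => ⟨h5, ?_,
      h7.mono le_rfl (Nat.le_succ k)⟩⟩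
    exact h6.trans (hPN.clock_mono i hi (he.time_mono (Nat.le_succ k)))
  · intro k a σ σ' out hact _ hσ hσ' ho hstep h h1 h2
    have hs : σ.Synced P := hσ ▸ he.synced hi k
    have keep : σ.view = w → σ.viewPlus = w → σ.currView = w ∧
      ∃ r < k + 1, e.Enters r i w ∧
        (σ.viewTimer = some (N.clock i (e.time (r + 1)) + P.F w) ∨
          σ.viewTimer = none ∧
            N.clock i (e.time (r + 1)) + P.F w ≤ N.clock i (e.time (k + 1)) ∧
            e.Wished i (w + 1) (k + 1)) := by
      intro h1 h2
      obtain ⟨h3, r, hr, hE, h4⟩ := h h1 h2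
      refine ⟨h3, r, hr.trans (Nat.lt_succ_self k), hE, h4.imp_right fun ⟨h5, h6, h7⟩ => ⟨h5, ?_,
        h7.mono le_rfl (Nat.le_succ k)⟩⟩
      exact h6.trans (hPN.clock_mono i hi (he.time_mono (Nat.le_succ k)))
    cases hstep with
    | start | retransmit | receiveOther | propose | vote | prepare | decide => exact keep h1 h2
    | viewTimeout _ d hd hc =>
      obtain ⟨h3, r, hr, hE, h4⟩ := keep h1 h2
      refine ⟨h3, r, hr, hE, Or.inr ⟨rfl, ?_, k, Nat.lt_succ_self k, max (σ.view + 1) σ.viewPlus,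
        ?_, hact, by rw [ho]; rfl⟩⟩
      · rcases h4 with h4 | h4
        · rw [hd] at h4
          exact (Option.some.inj h4) ▸ hc
        · exact h4.2.1
      · have : σ.view = w := h1
        omega
    | receiveWish _ _ l v hσ₁ hE =>
      have hv := Protocol.view_le_recordWish hs l v
      have hp := Protocol.viewPlus_le_recordWish hs l v
      have hle := hs.view_le
      rw [← hσ₁] at hv hp
      -- Had `view` grown to the common value `w`, the view would have been entered. So `view` was
      -- already `w`, and `view⁺`, being squeezed in between, was `w` too.
      have hnot : ¬ σ.view < σ'.view := fun hlt => hE ⟨by omega, hlt⟩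
      have := keep (by omega) (by omega)
      subst hσ₁
      exact this
    | enterView _ σ₁ l v hσ₁ hE =>
      have h1 : σ₁.view = w := h1
      refine ⟨h1, k, Nat.lt_succ_self k, ⟨hact, ?_, ?_⟩, Or.inl ?_⟩
      · have h3 := hE.2
        have h4 := hs.currView_le
        rw [hσ]
        omega
      · rw [hσ']; exact h1
      · simp [Protocol.newView, h1]

/-- The first wish for view `w + 1` is made by a process that has spent the time `F w` in view
`w`. -/
theorem exists_enters_of_wish (hPN : P.Admissible N) (he : e.IsExecution N) {w : ℕ} (hw : 0 < w)
    {s : ℕ} : ∀ {j : Fin P.n} {w' : ℕ}, w + 1 ≤ w' → e.Sends s j (.wish w') →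
    ∃ i ∈ N.correct, ∃ r < s, e.Enters r i w ∧
      N.clock i (e.time (r + 1)) + P.F w ≤ N.clock i (e.time (s + 1)) := by
  induction s using Nat.strong_induction_on with
  | _ s ih =>
  intro j w' hww hsend
  have early : ∀ l, e.Wished l (w + 1) s → ∃ i ∈ N.correct, ∃ r < s, e.Enters r i w ∧
      N.clock i (e.time (r + 1)) + P.F w ≤ N.clock i (e.time (s + 1)) := by
    rintro l ⟨q, hq, u, hu, hqs⟩
    obtain ⟨i, hi, r, hr, hE, hc⟩ := ih q hq hu hqs
    exact ⟨i, hi, r, hr.trans hq, hE, hc.trans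
      (hPN.clock_mono i hi (he.time_mono (by omega)))⟩
  have hj : j ∈ N.correct := hsend.1 ▸ he.actor_correct s
  -- If `view⁺` exceeds `w`, some correct process made such a wish earlier, and induction applies.
  -- Otherwise the wish can only be for `view + 1`, so `view = view⁺ = w` and the timer is off or
  -- just expiring.
  by_cases hp : w + 1 ≤ (e.state (s + 1) j).viewPlus
  · obtain ⟨l, -, hl⟩ := he.wished_of_le_viewPlus hPN hj (by omega) hp
    exact early l hl
  have hp0 : (e.state s j).viewPlus ≤ (e.state (s + 1) j).viewPlus :=
    he.viewPlus_mono hj (Nat.le_succ s)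
  have hle := (he.synced hj s).view_le
  have hstep := he.step_of_actor hsend.1
  have hout := hsend.2
  have htimer := he.timer_of_view_eq hPN hj hw s
  suffices hsuff : (e.state s j).view = w ∧ (∀ d, (e.state s j).viewTimer = some d →
      d ≤ N.clock j (e.time (s + 1))) by
    obtain ⟨-, r, hr, hE, h⟩ := htimer hsuff.1 (by omega)
    refine ⟨j, hj, r, hr, hE, ?_⟩
    rcases h with h | h
    · exact hsuff.2 _ h
    · exact h.2.1.trans (hPN.clock_mono j hj (he.time_mono (Nat.le_succ s)))
  clear htimer early hsend ih
  generalize e.state s j = σ at *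
  generalize e.state (s + 1) j = σ' at *
  generalize e.sent s = out at *
  generalize e.action s = a at *
  cases hstep with
  | start => split_ifs at hout <;> simp at hout; omega
  | receiveOther | propose | vote | prepare | decide => simp at hout
  | retransmit =>
    split_ifs at hout with h1 h2 <;>
      simp only [Set.mem_singleton_iff, Msg.wish.injEq, Set.mem_empty_iff_false] at hout
    · omega
    · refine ⟨by omega, fun d hd => ?_⟩
      simp [hd] at h1
  | viewTimeout _ d hd hc =>
    simp only [Set.mem_singleton_iff, Msg.wish.injEq] at hout
    refine ⟨by omega, fun d' hd' => ?_⟩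
    rw [hd] at hd'
    exact (Option.some.inj hd') ▸ hc
  | receiveWish _ _ l v hσ₁ hE => split_ifs at hout <;> simp at hout; omega
  | enterView _ σ₁ l v hσ₁ hE =>
    have hp : ¬ w + 1 ≤ σ₁.viewPlus := hp
    split_ifs at hout <;> simp at hout; omega

/-- If all correct processes have reached view `w`, they move on to view `w + 1`. -/
theorem le_view_succ (hPN : P.Admissible N) (he : e.IsExecution N) {w : ℕ} (hw : 0 < w) {t : ℝ}
    (ht : N.GST + P.ρ ≤ t) (h : ∀ i ∈ N.correct, w ≤ (e.state (e.stepsBy t) i).view)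
    {j : Fin P.n} (hj : j ∈ N.correct) :
    w + 1 ≤ (e.state (e.stepsBy (t + P.F w + N.δ)) j).view := by
  have hF := hPN.F_nonneg w
  have hρ := hPN.ρ_pos
  have hG := hPN.GST_nonneg
  refine he.le_view_of_forall_wished hPN (by omega) (by linarith) (fun i hi => ?_) hj
  have hK : e.stepsBy t ≤ e.stepsBy (t + P.F w) := he.stepsBy_mono (by linarith)
  by_cases hp : w + 1 ≤ (e.state (e.stepsBy (t + P.F w)) i).viewPlus
  · exact he.wished_viewPlus hi (by omega) _ hp
  have h0 := h i hi
  have h1 : _ ≤ _ := he.view_mono hi hK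
  have h2 : _ ≤ _ := he.viewPlus_mono hi hK
  have h3 := (he.synced hi (e.stepsBy t)).view_le
  have h4 := (he.synced hi (e.stepsBy (t + P.F w))).view_le
  simp only at h1 h2
  -- A process with `view⁺ ≤ w` has `view = view⁺ = w` both at `t` and at `t + F w`. The first fact
  -- shows that it entered `w` by time `t`, so its timer has run out by `t + F w`; the second gives
  -- the state of that timer.
  obtain ⟨hc, -⟩ := he.timer_of_view_eq hPN hi hw (e.stepsBy t) (by omega) (by omega)
  obtain ⟨-, r, hr, hE, hT⟩ := he.timer_of_view_eq hPN hi hw (e.stepsBy (t + P.F w))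
    (by omega) (by omega)
  rcases hT with hT | hT
  · have hrt := he.lt_stepsBy_iff.1 (Enters.lt_of_le he hi hE hc.ge)
    refine absurd (.viewTimeout _ _ hT ?_) (he.not_step_stepsBy (by linarith) hi
      (a := .viewTimeout) trivial)
    rw [hPN.clock_add hi (by linarith) hF]
    have := hPN.clock_mono i hi hrt
    linarith
  · exact hT.2.2

/-- The behaviour of the synchronizer in a view `w` that no correct process enters by
`GST + ρ`: there is a time `t₀` (the first entry) with the following properties. -/
theorem exists_first_entry (hPN : P.Admissible N) (he : e.IsExecution N) {w : ℕ} (hw : 0 < w)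
    (hlate : ∀ i ∈ N.correct, ∀ r, e.Enters r i w → N.GST + P.ρ < e.time (r + 1))
    {j : Fin P.n} {k : ℕ} (hwish : e.Wished j (w + 1) k) :
    ∃ t₀, N.GST + P.ρ < t₀ ∧
      (∀ i ∈ N.correct, ∀ r, e.Enters r i w → t₀ ≤ e.time (r + 1)) ∧
      (∀ i ∈ N.correct, w ≤ (e.state (e.stepsBy (t₀ + 2 * N.δ)) i).view) ∧
      ∀ i ∈ N.correct, ∀ k, e.time k < t₀ + P.F w → w ≤ (e.state k i).view →
        (e.state k i).view = w ∧ (e.state k i).viewPlus = w ∧ (e.state k i).currView = w := by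
  classical
  have hρ := hPN.ρ_pos
  obtain ⟨s, -, w', hww, hsend⟩ := hwish
  have hex : ∃ r, ∃ i ∈ N.correct, e.Enters r i w := by
    obtain ⟨i, hi, r, -, hE, -⟩ := he.exists_enters_of_wish hPN hw hww hsend
    exact ⟨r, i, hi, hE⟩
  obtain ⟨i₀, hi₀, hE₀⟩ := Nat.find_spec hex
  have hmin : ∀ i ∈ N.correct, ∀ r, e.Enters r i w →
      e.time (Nat.find hex + 1) ≤ e.time (r + 1) := fun i hi r hr =>
    he.time_mono (Nat.succ_le_succ (Nat.find_min' hex ⟨i, hi, hr⟩))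
  refine ⟨e.time (Nat.find hex + 1), hlate i₀ hi₀ _ hE₀, hmin, fun i hi => ?_,
    fun i hi k hk hv => ?_⟩
  · have hv : w ≤ (e.state (Nat.find hex + 1) i₀).view :=
      hE₀.2.2.ge.trans (he.synced hi₀ _).currView_le
    obtain ⟨A, hA, hcard, hAw⟩ := he.wished_of_le_view hPN hi₀ hw hv
    exact he.le_view_of_wished hPN hw (hlate i₀ hi₀ _ hE₀).le hA hcard
      (fun i hi => (hAw i hi).mono le_rfl ((Nat.le_succ _).trans
        (he.lt_stepsBy_iff.2 le_rfl))) hi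
  · have hle := (he.synced hi k).view_le
    -- A larger `view⁺` would stem from a wish made after some correct process had spent `F w` in
    -- view `w`. That process entered after `GST`, so its clock measures real time and the wish was
    -- made no earlier than `t₀ + F w`.
    have hp : ¬ w + 1 ≤ (e.state k i).viewPlus := by
      intro hp
      obtain ⟨l, -, q, hq, u, hu, hqs⟩ := he.wished_of_le_viewPlus hPN hi (by omega) hp
      obtain ⟨m, hm, r, hr, hE, hc⟩ := he.exists_enters_of_wish hPN hw hu hqs
      have h1 := hPN.le_of_clock_le hm ((by linarith : N.GST ≤ N.GST + P.ρ).trans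
        (hlate m hm r hE).le) (he.time_mono (by omega)) hc
      have h2 := hmin m hm r hE
      have h3 : e.time (q + 1) ≤ e.time k := he.time_mono (by omega)
      linarith
    have h1 : (e.state k i).view = w := by omega
    have h2 : (e.state k i).viewPlus = w := by omega
    exact ⟨h1, h2, (he.timer_of_view_eq hPN hi hw k h1 h2).1⟩

end IsExecution
end Trace
/-! ### The consensus protocol: single steps -/

section Steps

variable {Value Hash : Type*} {P : Protocol Value Hash}

/-- State invariant of the consensus protocol. -/
structure PState.Coherent (P : Protocol Value Hash) (σ : PState P.n Value Hash) : Prop where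
  locked_eq : σ.lockedView = σ.preparedView
  prepared_le : σ.preparedView ≤ σ.currView
  prepared_lt : σ.voted = false → 0 < σ.currView → σ.preparedView < σ.currView
  voted_pos : σ.voted = true → 0 < σ.currView
  prepared_cert : σ.preparedView ≠ 0 → ∃ x, σ.preparedVal = some x ∧
    PreparedCert P.f σ.cert σ.preparedView (P.hash x)

namespace Protocol

theorem Initial.coherent {c : ℝ} {σ : PState P.n Value Hash} (h : P.Initial c σ) :
    σ.Coherent P := by
  obtain ⟨-, -, -, -, -, h1, h2, -, -, h3, h4, -⟩ := h
  exact ⟨by omega, by omega, by omega, by simp [h2], by omega⟩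

/-- A leader can always choose a proposal. -/
theorem exists_choosesProposal (i : Fin P.n) (σ : PState P.n Value Hash) (v : ℕ) :
    ∃ x C, P.ChoosesProposal i σ v x C := by
  let S : Set (Fin P.n) := {j | ∃ w val D, (j, Msg.newLeader v w val D) ∈ σ.received ∧
    P.ValidNewLeader v w val D}
  have hsel : ∀ j, ∃ q : ℕ × Option Value × Cert P.n Hash, j ∈ S →
      (j, Msg.newLeader v q.1 q.2.1 q.2.2) ∈ σ.received ∧
        P.ValidNewLeader v q.1 q.2.1 q.2.2 := by
    intro j
    by_cases hj : j ∈ S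
    · obtain ⟨w, val, D, h⟩ := hj
      exact ⟨(w, val, D), fun _ => h⟩
    · exact ⟨(0, none, ∅), fun h => absurd h hj⟩
  choose sel hsel using hsel
  by_cases h0 : ∀ j ∈ S, (sel j).1 = 0
  · exact ⟨_, _, S, sel, fun _ => Iff.rfl, hsel, Or.inr ⟨h0, rfl, rfl⟩⟩
  · push Not at h0
    obtain ⟨l, hl, hl0⟩ := h0
    obtain ⟨j, hj, hmax⟩ := Set.exists_max_image S (fun j => (sel j).1) (Set.toFinite S) ⟨l, hl⟩
    have hj0 : (sel j).1 ≠ 0 := by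
      have : (sel l).1 ≤ (sel j).1 := hmax l hl
      omega
    obtain ⟨x, hx, -⟩ := (hsel j hj).2.2 hj0
    exact ⟨x, _, S, sel, fun _ => Iff.rfl, hsel, Or.inl ⟨j, hj, hj0, hmax, hx, rfl⟩⟩

namespace Step

variable {i : Fin P.n} {c : ℝ} {a : Action P.n Value Hash} {σ σ' : PState P.n Value Hash}
  {out : Set (Msg P.n Value Hash)}

theorem coherent (h : P.Step i c a σ σ' out) (hs : σ.Synced P) (hc : σ.Coherent P) :
    σ'.Coherent P := by
  cases h with
  | start | retransmit | receiveOther | propose | decide | viewTimeout =>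
    exact ⟨hc.locked_eq, hc.prepared_le, hc.prepared_lt, hc.voted_pos, hc.prepared_cert⟩
  | receiveWish _ _ j v hσ₁ hE =>
    subst hσ₁
    exact ⟨hc.locked_eq, hc.prepared_le, hc.prepared_lt, hc.voted_pos, hc.prepared_cert⟩
  | enterView _ σ₁ j v hσ₁ hE =>
    have h1 := hs.currView_le
    have h2 := hE.2
    have h3 := hc.prepared_le
    subst hσ₁
    exact ⟨hc.locked_eq, h3.trans (h1.trans h2.le), fun _ _ => h3.trans_lt (h1.trans_lt h2),
      fun h => by simp [newView] at h, hc.prepared_cert⟩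
  | vote _ j x C hpos hr hv hsafe =>
    exact ⟨hc.locked_eq, hc.prepared_le, fun h => by simp at h, fun _ => hpos, hc.prepared_cert⟩
  | prepare _ Q x hQ hr hv hx hfirst =>
    exact ⟨rfl, le_rfl, fun h => by simp [hv] at h, hc.voted_pos, fun _ => ⟨x, rfl, Q, hQ, rfl⟩⟩

/-- This and the next three lemmas are inversions: each kind of consensus message is sent by a
single handler, whose guard can therefore be read off. -/
theorem of_newLeader_mem (h : P.Step i c a σ σ' out) (hs : σ.Synced P) {u w : ℕ}
    {val : Option Value} {D : Cert P.n Hash} (hm : .newLeader u w val D ∈ out) :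
    σ.currView < u ∧ σ'.currView = u ∧ w = σ.preparedView ∧ val = σ.preparedVal ∧ D = σ.cert ∧
      σ'.preparedView = σ.preparedView ∧ σ'.preparedVal = σ.preparedVal := by
  cases h with
  | start => split_ifs at hm <;> simp at hm
  | retransmit => split_ifs at hm <;> simp at hm
  | receiveOther | propose | decide | viewTimeout | vote | prepare => simp at hm
  | receiveWish => split_ifs at hm <;> simp at hm
  | enterView _ σ₁ j v hσ₁ hE =>
    have h1 := hs.currView_le
    have h2 := hE.2
    rcases hm with hm | hm
    · simp only [Set.mem_singleton_iff, Msg.newLeader.injEq] at hm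
      obtain ⟨rfl, rfl, rfl, rfl⟩ := hm
      subst hσ₁
      exact ⟨h1.trans_lt h2, rfl, rfl, rfl, rfl, rfl, rfl⟩
    · split_ifs at hm <;> simp at hm

theorem of_propose_mem (h : P.Step i c a σ σ' out) {u : ℕ} {x : Value} {C : Cert P.n Hash}
    (hm : .propose u x C ∈ out) :
    out = {.propose u x C} ∧ σ.currView = u ∧ i = P.leader u ∧
      (∃ d, σ.newLeaderTimer = some d ∧ d ≤ c) ∧ P.ChoosesProposal i σ u x C := by
  cases h with
  | start => split_ifs at hm <;> simp at hm
  | retransmit => split_ifs at hm <;> simp at hm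
  | receiveOther | decide | viewTimeout | vote | prepare => simp at hm
  | receiveWish => split_ifs at hm <;> simp at hm
  | enterView _ σ₁ j v hσ₁ hE => split_ifs at hm <;> simp at hm
  | propose _ d x' C' hd hc hl hx =>
    simp only [Set.mem_singleton_iff, Msg.propose.injEq] at hm
    obtain ⟨rfl, rfl, rfl⟩ := hm
    exact ⟨rfl, rfl, hl, ⟨d, hd, hc⟩, hx⟩

theorem of_prepared_mem (h : P.Step i c a σ σ' out) {u : ℕ} {η : Hash}
    (hm : .prepared u η ∈ out) :
    out = {.prepared u η} ∧ σ.currView = u ∧ 0 < u ∧ σ.voted = false ∧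
      ∃ j x C, η = P.hash x ∧ (j, .propose u x C) ∈ σ.received ∧ P.SafeProposal σ j u x C := by
  cases h with
  | start => split_ifs at hm <;> simp at hm
  | retransmit => split_ifs at hm <;> simp at hm
  | receiveOther | decide | viewTimeout | propose | prepare => simp at hm
  | receiveWish => split_ifs at hm <;> simp at hm
  | enterView _ σ₁ j v hσ₁ hE => split_ifs at hm <;> simp at hm
  | vote _ j x C hpos hr hv hsafe =>
    simp only [Set.mem_singleton_iff, Msg.prepared.injEq] at hm
    obtain ⟨rfl, rfl⟩ := hm
    exact ⟨rfl, rfl, hpos, hv, j, x, C, rfl, hr, hsafe⟩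

theorem of_committed_mem (h : P.Step i c a σ σ' out) {u : ℕ} {η : Hash}
    (hm : .committed u η ∈ out) : σ.currView = u := by
  cases h with
  | start => split_ifs at hm <;> simp at hm
  | retransmit => split_ifs at hm <;> simp at hm
  | receiveOther | decide | viewTimeout | propose | vote => simp at hm
  | receiveWish => split_ifs at hm <;> simp at hm
  | enterView _ σ₁ j v hσ₁ hE => split_ifs at hm <;> simp at hm
  | prepare _ Q x hQ hr hv hx hfirst =>
    simp only [Set.mem_singleton_iff, Msg.committed.injEq] at hm
    exact hm.1.symm

end Step
end Protocol
end Steps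

/-! ### The consensus protocol: executions -/

namespace Trace

variable {Value Hash : Type*} {P : Protocol Value Hash} {N : Env P.n} {e : Trace P}

namespace IsExecution

theorem coherent (he : e.IsExecution N) {i : Fin P.n} (hi : i ∈ N.correct) (k : ℕ) :
    (e.state k i).Coherent P :=
  he.induct hi (Φ := fun _ σ => σ.Coherent P) (fun _ h => h.coherent) (fun _ _ _ _ h => h)
    (fun k _ _ _ _ _ _ hσ _ _ h hc => h.coherent (hσ ▸ he.synced hi k) hc) k

theorem exists_enters (he : e.IsExecution N) {i : Fin P.n} (hi : i ∈ N.correct) {k w : ℕ}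
    (hw : 0 < w) : (e.state k i).currView = w → ∃ r < k, e.Enters r i w := by
  induction k with
  | zero =>
    intro h
    have := (he.init i hi).2.2.2.2.2.1
    omega
  | succ k ih =>
    intro h
    by_cases hk : e.actor k = i
    · have hle : (e.state k i).currView ≤ (e.state (k + 1) i).currView :=
        he.currView_mono hi (Nat.le_succ k)
      rcases hle.lt_or_eq with hlt | heq
      · exact ⟨k, Nat.lt_succ_self k, hk, by omega, h⟩
      · obtain ⟨r, hr, hE⟩ := ih (heq.trans h)
        exact ⟨r, by omega, hE⟩
    · rw [he.frame k i (Ne.symm hk)] at h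
      obtain ⟨r, hr, hE⟩ := ih h
      exact ⟨r, by omega, hE⟩

theorem receives_of_mem_received (he : e.IsExecution N) {i : Fin P.n} (hi : i ∈ N.correct)
    {j : Fin P.n} {m : Msg P.n Value Hash} (k : ℕ) :
    (j, m) ∈ (e.state k i).received → ∃ s < k, e.Receives s i j m := by
  refine he.induct hi (Φ := fun k σ => (j, m) ∈ σ.received → ∃ s < k, e.Receives s i j m)
    ?_ ?_ ?_ k
  · intro σ hσ h
    simp [hσ.2.2.2.2.2.2.2.2.2.2.2.2.2.1] at h
  · intro k σ _ _ h hm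
    obtain ⟨s, hs, h⟩ := h hm
    exact ⟨s, by omega, h⟩
  · intro k a σ σ' out hact ha _ _ _ hstep h hm
    have keep : (j, m) ∈ σ.received → ∃ s < k + 1, e.Receives s i j m := fun hm => by
      obtain ⟨s, hs, h⟩ := h hm
      exact ⟨s, by omega, h⟩
    cases hstep with
    | start | retransmit | propose | decide | viewTimeout | vote | prepare => exact keep hm
    | receiveWish _ _ j v hσ₁ hE => subst hσ₁; exact keep hm
    | enterView _ σ₁ j v hσ₁ hE => subst hσ₁; exact keep hm
    | receiveOther =>
      rcases hm with hm | hm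
      · obtain ⟨rfl, rfl⟩ := Prod.mk.inj hm
        exact ⟨k, by omega, hact, ha⟩
      · exact keep hm

theorem mem_received_of_receives (he : e.IsExecution N) {i j : Fin P.n}
    {m : Msg P.n Value Hash} {k : ℕ} (h : e.Receives k i j m) (hm : ∀ v, m ≠ .wish v) :
    (j, m) ∈ (e.state (k + 1) i).received := by
  have hstep := he.step_of_actor h.1
  rw [h.2] at hstep
  generalize e.state k i = σ at hstep
  generalize e.state (k + 1) i = σ' at hstep
  generalize e.sent k = out at hstep
  cases hstep with
  | receiveWish _ _ _ v hσ₁ hE => exact absurd rfl (hm v)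
  | enterView _ σ₁ _ v hσ₁ hE => exact absurd rfl (hm v)
  | receiveOther _ _ _ hm => exact Set.mem_insert _ _

theorem mem_received_of_sends (he : e.IsExecution N) {i j : Fin P.n} (hj : j ∈ N.correct)
    {m : Msg P.n Value Hash} {k : ℕ} (h : e.Sends k i m) (hm : ∀ v, m ≠ .wish v)
    (hto : P.SentTo m j) (hG : N.GST ≤ e.time (k + 1)) {t : ℝ} (ht : e.time (k + 1) + N.δ ≤ t) :
    (i, m) ∈ (e.state (e.stepsBy t) j).received := by
  obtain ⟨q, -, hq, hqt⟩ := he.delivery k i j m hj h hto hG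
  exact he.received_mono hj (he.lt_stepsBy_iff.2 (hqt.trans ht) : q + 1 ≤ e.stepsBy t)
    (he.mem_received_of_receives hq hm)

theorem occurs_of_receives {i j : Fin P.n} {m : Msg P.n Value Hash} {k : ℕ}
    (h : e.Receives k i j m) {x : Value} (hx : m.Carries x) : e.Occurs x :=
  ⟨k, m, Or.inr ⟨j, h.2⟩, hx⟩

/-- The contents of the `NEWLEADER` message of a process reflect its state until it votes. -/
theorem eq_of_sends_newLeader (he : e.IsExecution N) {i : Fin P.n} (hi : i ∈ N.correct)
    {s u w : ℕ} {val : Option Value} {D : Cert P.n Hash}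
    (hsend : e.Sends s i (.newLeader u w val D)) (k : ℕ) :
    s < k → u ≤ (e.state k i).currView ∧ (u = (e.state k i).currView →
      (e.state k i).voted = false → w = (e.state k i).preparedView ∧
        val = (e.state k i).preparedVal) := by
  refine he.induct hi (Φ := fun k σ => s < k → u ≤ σ.currView ∧ (u = σ.currView →
      σ.voted = false → w = σ.preparedView ∧ val = σ.preparedVal)) ?_ ?_ ?_ k
  · intro σ _ h
    omega
  · intro k σ _ hk h hs
    have : s ≠ k := fun h => hk (h ▸ hsend.1)
    exact h (by omega)
  · intro k a σ σ' out hact _ hσ hσ' ho hstep h hs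
    have hsy : σ.Synced P := hσ ▸ he.synced hi k
    rcases Nat.lt_succ_iff_lt_or_eq.1 hs with hs | rfl
    · have h := h hs
      cases hstep with
      | start | retransmit | propose | decide | viewTimeout | receiveOther => exact h
      | vote => exact ⟨h.1, fun _ hv => by simp at hv⟩
      -- The prepared value and view change only here, and this handler requires a vote.
      | prepare _ Q x hQ hr hv => exact ⟨h.1, fun _ hv' => by simp [hv] at hv'⟩
      | receiveWish _ _ _ v hσ₁ hE => subst hσ₁; exact h
      | enterView _ σ₁ j v hσ₁ hE =>
        have hlt := h.1.trans_lt (hsy.currView_le.trans_lt hE.2)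
        exact ⟨hlt.le, fun h => absurd h hlt.ne⟩
    · obtain ⟨h1, h2, h3, h4, -, h5, h6⟩ := hstep.of_newLeader_mem hsy (ho ▸ hsend.2)
      exact ⟨h2.ge, fun _ _ => ⟨h3.trans h5.symm, h4.trans h6.symm⟩⟩

/-- Every process that has entered a view has sent a valid `NEWLEADER` message. -/
theorem exists_sends_newLeader (he : e.IsExecution N) {i : Fin P.n} (hi : i ∈ N.correct)
    {r u : ℕ} (hE : e.Enters r i u) :
    ∃ w val D, e.Sends r i (.newLeader u w val D) ∧ P.ValidNewLeader u w val D := by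
  have hs := he.synced hi r
  have hc := he.coherent hi r
  have hstep := he.step_of_actor hE.1
  obtain ⟨hact, h1, h2⟩ := hE
  unfold Sends
  generalize e.state r i = σ at *
  generalize e.state (r + 1) i = σ' at *
  generalize e.sent r = out at *
  generalize e.action r = a at *
  cases hstep with
  | start | retransmit | propose | decide | viewTimeout | receiveOther | vote | prepare =>
    exact absurd h2 h1.ne
  | receiveWish _ _ _ v hσ₁ hE => subst hσ₁; exact absurd h2 h1.ne
  | enterView _ σ₁ j v hσ₁ hE =>
    have h2 : σ₁.view = u := h2
    exact ⟨_, _, _, ⟨hact, Or.inl (by rw [h2]; rfl)⟩, hc.prepared_le.trans_lt h1,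
      hc.prepared_cert⟩

/-- A process sends `PREPARED` messages only for views up to its current one, and only after having
voted. -/
theorem voted_of_sends_prepared (he : e.IsExecution N) {i : Fin P.n} (hi : i ∈ N.correct)
    {s u : ℕ} {η : Hash} (hsend : e.Sends s i (.prepared u η)) (k : ℕ) :
    s < k → u ≤ (e.state k i).currView ∧
      (u = (e.state k i).currView → (e.state k i).voted = true) := by
  refine he.induct hi (Φ := fun k σ => s < k → u ≤ σ.currView ∧ (u = σ.currView →
      σ.voted = true)) ?_ ?_ ?_ k
  · intro σ _ h
    omega
  · intro k σ _ hk h hs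
    have : s ≠ k := fun h => hk (h ▸ hsend.1)
    exact h (by omega)
  · intro k a σ σ' out hact _ hσ hσ' ho hstep h hs
    have hsy : σ.Synced P := hσ ▸ he.synced hi k
    rcases Nat.lt_succ_iff_lt_or_eq.1 hs with hs | rfl
    · have h := h hs
      cases hstep with
      | start | retransmit | propose | decide | viewTimeout | receiveOther | prepare => exact h
      | vote => exact ⟨h.1, fun _ => rfl⟩
      | receiveWish _ _ _ v hσ₁ hE => subst hσ₁; exact h
      | enterView _ σ₁ j v hσ₁ hE =>
        have hlt := h.1.trans_lt (hsy.currView_le.trans_lt hE.2)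
        exact ⟨hlt.le, fun h => absurd h hlt.ne⟩
    · have hm : .prepared u η ∈ out := ho ▸ hsend.2
      have h1 := (hstep.of_prepared_mem hm).2.1
      cases hstep with
      | start => split_ifs at hm <;> simp at hm
      | retransmit => split_ifs at hm <;> simp at hm
      | receiveOther | decide | viewTimeout | propose | prepare => simp at hm
      | receiveWish => split_ifs at hm <;> simp at hm
      | enterView _ σ₁ j v hσ₁ hE => split_ifs at hm <;> simp at hm
      | vote => exact ⟨h1.ge, fun _ => rfl⟩

/-- A vote requires `voted = false`, while an earlier vote keeps the flag true until the view
changes. Quorum intersection needs this to exclude conflicting certificates. -/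
theorem prepared_unique (he : e.IsExecution N) {i : Fin P.n} (hi : i ∈ N.correct)
    {s s' u : ℕ} {η η' : Hash} (h : e.Sends s i (.prepared u η))
    (h' : e.Sends s' i (.prepared u η')) : η = η' := by
  have hne : ∀ {s s' : ℕ} {η η' : Hash}, e.Sends s i (.prepared u η) →
      e.Sends s' i (.prepared u η') → ¬ s < s' := by
    intro s s' η η' h h' hlt
    obtain ⟨-, h1, -, h2, -⟩ := (he.step_of_actor h'.1).of_prepared_mem h'.2
    have h3 := (he.voted_of_sends_prepared hi h s' hlt).2 h1.symm
    rw [h2] at h3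
    exact Bool.noConfusion h3
  obtain rfl : s = s' := le_antisymm (not_lt.1 (hne h' h)) (not_lt.1 (hne h h'))
  have h1 := ((he.step_of_actor h.1).of_prepared_mem h.2).1
  have h2 := h'.2
  rw [h1] at h2
  simpa using h2.symm

/-- A process that has voted in its current view has voted for a proposal of the leader. -/
theorem exists_vote (he : e.IsExecution N) {i : Fin P.n} (hi : i ∈ N.correct) (k : ℕ) :
    (e.state k i).voted = true → ∃ s < k, ∃ x C, (e.state k i).currVal = some x ∧
      e.Sends s i (.prepared (e.state k i).currView (P.hash x)) ∧
      (P.leader (e.state k i).currView, .propose (e.state k i).currView x C) ∈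
        (e.state k i).received := by
  refine he.induct hi (Φ := fun k σ => σ.voted = true → ∃ s < k, ∃ x C, σ.currVal = some x ∧
      e.Sends s i (.prepared σ.currView (P.hash x)) ∧
      (P.leader σ.currView, .propose σ.currView x C) ∈ σ.received) ?_ ?_ ?_ k
  · intro σ hσ h
    simp [hσ.2.2.2.2.2.2.1] at h
  · intro k σ _ _ h hv
    obtain ⟨s, hs, h⟩ := h hv
    exact ⟨s, by omega, h⟩
  · intro k a σ σ' out hact _ hσ hσ' ho hstep h hv
    have keep : σ.voted = true → ∃ s < k + 1, ∃ x C, σ.currVal = some x ∧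
        e.Sends s i (.prepared σ.currView (P.hash x)) ∧
        (P.leader σ.currView, .propose σ.currView x C) ∈ σ.received := fun hv => by
      obtain ⟨s, hs, h⟩ := h hv
      exact ⟨s, by omega, h⟩
    cases hstep with
    | start | retransmit | propose | decide | viewTimeout | prepare => exact keep hv
    | receiveOther =>
      obtain ⟨s, hs, x, C, h1, h2, h3⟩ := keep hv
      exact ⟨s, hs, x, C, h1, h2, Set.mem_insert_of_mem _ h3⟩
    | receiveWish _ _ _ v hσ₁ hE => subst hσ₁; exact keep hv
    | enterView _ σ₁ j v hσ₁ hE => simp [Protocol.newView] at hv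
    | vote _ j x C hpos hr hv hs =>
      exact ⟨k, by omega, x, C, rfl, ⟨hact, by rw [ho]; rfl⟩, hs.1 ▸ hr⟩

/-- A process locked on its current view has sent a `COMMITTED` message. -/
theorem exists_sends_committed (he : e.IsExecution N) {i : Fin P.n} (hi : i ∈ N.correct)
    (k : ℕ) : 0 < (e.state k i).currView →
    (e.state k i).lockedView = (e.state k i).currView → ∃ s < k, ∃ x,
      (e.state k i).currVal = some x ∧
      e.Sends s i (.committed (e.state k i).currView (P.hash x)) := by
  refine he.induct hi (Φ := fun k σ => 0 < σ.currView → σ.lockedView = σ.currView →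
      ∃ s < k, ∃ x, σ.currVal = some x ∧ e.Sends s i (.committed σ.currView (P.hash x))) ?_ ?_ ?_ k
  · intro σ hσ h
    have := hσ.2.2.2.2.2.1
    omega
  · intro k σ _ _ h hp hl
    obtain ⟨s, hs, h⟩ := h hp hl
    exact ⟨s, by omega, h⟩
  · intro k a σ σ' out hact _ hσ hσ' ho hstep h hp hl
    have keep : 0 < σ.currView → σ.lockedView = σ.currView →
        ∃ s < k + 1, ∃ x, σ.currVal = some x ∧
          e.Sends s i (.committed σ.currView (P.hash x)) := fun hp hl => by
      obtain ⟨s, hs, h⟩ := h hp hl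
      exact ⟨s, by omega, h⟩
    have hsy : σ.Synced P := hσ ▸ he.synced hi k
    have hco : σ.Coherent P := hσ ▸ he.coherent hi k
    cases hstep with
    | start | retransmit | propose | decide | viewTimeout | receiveOther => exact keep hp hl
    | receiveWish _ _ _ v hσ₁ hE => subst hσ₁; exact keep hp hl
    -- Neither entering a view nor voting can leave a process locked on its current view: in both
    -- cases the lock belongs to a smaller view. So `currVal` does not change once the lock is
    -- acquired in a view.
    | enterView _ σ₁ j v hσ₁ hE =>
      have h1 := hco.locked_eq
      have h2 := hco.prepared_le
      have h3 := hsy.currView_le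
      have h4 := hE.2
      have h5 : σ₁.lockedView = σ.lockedView := by subst hσ₁; rfl
      have h6 : σ₁.lockedView = σ₁.view := hl
      omega
    | vote _ j x C hpos hr hv hs =>
      have h1 := hco.locked_eq
      have h2 := hco.prepared_lt hv hpos
      simp only at hl
      omega
    | prepare _ Q x hQ hr hv hx hfirst =>
      exact ⟨k, by omega, x, hx, hact, by rw [ho]; rfl⟩

theorem exists_decide (he : e.IsExecution N) {i : Fin P.n} (hi : i ∈ N.correct) (k : ℕ) :
    (e.state k i).decided ≠ none → ∃ s < k, ∃ x, e.actor s = i ∧ e.action s = .decide x := by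
  refine he.induct hi (Φ := fun k σ => σ.decided ≠ none → ∃ s < k, ∃ x, e.actor s = i ∧
      e.action s = .decide x) ?_ ?_ ?_ k
  · intro σ hσ h
    exact absurd hσ.2.2.2.2.2.2.2.2.2.2.2.2.2.2 h
  · intro k σ _ _ h hd
    obtain ⟨s, hs, h⟩ := h hd
    exact ⟨s, by omega, h⟩
  · intro k a σ σ' out hact ha _ _ _ hstep h hd
    have keep : σ.decided ≠ none → ∃ s < k + 1, ∃ x, e.actor s = i ∧
        e.action s = .decide x := fun hd => by
      obtain ⟨s, hs, h⟩ := h hd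
      exact ⟨s, by omega, h⟩
    cases hstep with
    | start | retransmit | propose | viewTimeout | receiveOther | vote | prepare => exact keep hd
    | receiveWish _ _ _ v hσ₁ hE => subst hσ₁; exact keep hd
    | enterView _ σ₁ j v hσ₁ hE => subst hσ₁; exact keep hd
    | decide _ Q x => exact ⟨k, by omega, x, hact, ha⟩

/-- The leader of a view has either sent its proposal or its timer is running. -/
theorem newLeaderTimer_eq (he : e.IsExecution N) {i : Fin P.n} (hi : i ∈ N.correct) {r u : ℕ}
    (hE : e.Enters r i u) (hl : i = P.leader u) (k : ℕ) :
    r < k → (e.state k i).currView = u →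
      (e.state k i).newLeaderTimer = some (N.clock i (e.time (r + 1)) + P.Fp u) ∨
      (e.state k i).newLeaderTimer = none ∧ ∃ s < k, ∃ x C, e.Sends s i (.propose u x C) := by
  refine he.induct hi (Φ := fun k σ => r < k → σ.currView = u →
      σ.newLeaderTimer = some (N.clock i (e.time (r + 1)) + P.Fp u) ∨
      σ.newLeaderTimer = none ∧ ∃ s < k, ∃ x C, e.Sends s i (.propose u x C)) ?_ ?_ ?_ k
  · intro σ _ h
    omega
  · intro k σ _ hk h hr hu
    have : r ≠ k := fun h => hk (h ▸ hE.1)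
    refine (h (by omega) hu).imp_right fun ⟨h1, s, hs, h⟩ => ⟨h1, s, by omega, h⟩
  · intro k a σ σ' out hact _ hσ hσ' ho hstep h hr hu
    have hsy : σ.Synced P := hσ ▸ he.synced hi k
    have keep : r ≠ k → σ.currView = u →
        σ.newLeaderTimer = some (N.clock i (e.time (r + 1)) + P.Fp u) ∨
        σ.newLeaderTimer = none ∧ ∃ s < k + 1, ∃ x C, e.Sends s i (.propose u x C) :=
      fun hne hu => (h (by omega) hu).imp_right fun ⟨h1, s, hs, h⟩ => ⟨h1, s, by omega, h⟩
    have hne : σ.currView = u → r ≠ k := by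
      rintro hu rfl
      have := hE.2.1
      rw [hσ] at this
      omega
    cases hstep with
    | start | retransmit | viewTimeout | receiveOther | vote | prepare | decide =>
      exact keep (hne hu) hu
    | receiveWish _ _ _ v hσ₁ hE => subst hσ₁; exact keep (hne hu) hu
    | enterView _ σ₁ j v hσ₁ hEn =>
      have hu' : σ₁.view = u := hu
      have hk : e.Enters k i u := ⟨hact, by
        have h1 := hsy.currView_le
        have h2 := hEn.2
        rw [hσ]
        omega, by rw [hσ']; exact hu⟩
      obtain rfl := Enters.unique he hi hE hk
      left
      simp [Protocol.newView, hu', ← hl]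
    | propose _ d x C hd hc hl hx =>
      exact Or.inr ⟨rfl, k, by omega, x, C, hact, by rw [ho, ← hu]; rfl⟩

/-- Proposing switches the timer off, and only the entry into a higher view can start it again.
Hence a correct leader proposes once per view. -/
theorem newLeaderTimer_of_sends_propose (he : e.IsExecution N) {i : Fin P.n}
    (hi : i ∈ N.correct) {s u : ℕ} {x : Value} {C : Cert P.n Hash}
    (hsend : e.Sends s i (.propose u x C)) (k : ℕ) :
    s < k → u ≤ (e.state k i).currView ∧
      (u = (e.state k i).currView → (e.state k i).newLeaderTimer = none) := by
  refine he.induct hi (Φ := fun k σ => s < k → u ≤ σ.currView ∧ (u = σ.currView →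
      σ.newLeaderTimer = none)) ?_ ?_ ?_ k
  · intro σ _ h
    omega
  · intro k σ _ hk h hs
    have : s ≠ k := fun h => hk (h ▸ hsend.1)
    exact h (by omega)
  · intro k a σ σ' out hact _ hσ hσ' ho hstep h hs
    have hsy : σ.Synced P := hσ ▸ he.synced hi k
    rcases Nat.lt_succ_iff_lt_or_eq.1 hs with hs | rfl
    · have h := h hs
      cases hstep with
      | start | retransmit | vote | decide | viewTimeout | receiveOther | prepare => exact h
      | propose => exact ⟨h.1, fun _ => rfl⟩
      | receiveWish _ _ _ v hσ₁ hE => subst hσ₁; exact h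
      | enterView _ σ₁ j v hσ₁ hE =>
        have hlt := h.1.trans_lt (hsy.currView_le.trans_lt hE.2)
        exact ⟨hlt.le, fun h => absurd h hlt.ne⟩
    · have hm : .propose u x C ∈ out := ho ▸ hsend.2
      have h1 := (hstep.of_propose_mem hm).2.1
      cases hstep with
      | start => split_ifs at hm <;> simp at hm
      | retransmit => split_ifs at hm <;> simp at hm
      | receiveOther | decide | viewTimeout | vote | prepare => simp at hm
      | receiveWish => split_ifs at hm <;> simp at hm
      | enterView _ σ₁ j v hσ₁ hE => split_ifs at hm <;> simp at hm
      | propose => exact ⟨h1.ge, fun _ => rfl⟩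

theorem propose_unique (he : e.IsExecution N) {i : Fin P.n} (hi : i ∈ N.correct)
    {s s' u : ℕ} {x x' : Value} {C C' : Cert P.n Hash} (h : e.Sends s i (.propose u x C))
    (h' : e.Sends s' i (.propose u x' C')) : x = x' := by
  have hne : ∀ {s s' : ℕ} {x x' : Value} {C C' : Cert P.n Hash}, e.Sends s i (.propose u x C) →
      e.Sends s' i (.propose u x' C') → ¬ s < s' := by
    intro s s' x x' C C' h h' hlt
    obtain ⟨-, h1, -, ⟨d, h2, -⟩, -⟩ := (he.step_of_actor h'.1).of_propose_mem h'.2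
    have h3 := (he.newLeaderTimer_of_sends_propose hi h s' hlt).2 h1.symm
    rw [h2] at h3
    exact Option.noConfusion rfl (heq_of_eq h3)
  obtain rfl : s = s' := le_antisymm (not_lt.1 (hne h' h)) (not_lt.1 (hne h h'))
  have h1 := ((he.step_of_actor h.1).of_propose_mem h.2).1
  have h2 := h'.2
  rw [h1] at h2
  simp only [Set.mem_singleton_iff, Msg.propose.injEq, true_and] at h2
  exact h2.1.symm

/-- The correct signers in a certificate received by a correct process have sent the respective
message. -/
theorem exists_sends_of_cert (he : e.IsExecution N) {i j : Fin P.n} {k u w : ℕ}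
    {val : Option Value} {D : Cert P.n Hash} (hrec : e.Receives k i j (.newLeader u w val D))
    {η : Hash} {Q : Finset (Fin P.n)} (hD : D = {s | s.1 ∈ Q ∧ s.2 = (w, η)}) {l : Fin P.n}
    (hl : l ∈ Q) (hlc : l ∈ N.correct) : ∃ s, e.Sends s l (.prepared w η) := by
  obtain ⟨s, -, hs⟩ := he.unforgeable k i j _ l w η hrec
    (show (l, w, η) ∈ D by rw [hD]; exact ⟨hl, rfl⟩) hlc
  exact ⟨s, hs⟩

/-- Certified values are valid. -/
theorem valid_of_cert (hPN : P.Admissible N) (he : e.IsExecution N) {i j : Fin P.n}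
    {k u w : ℕ} {x : Value} {D : Cert P.n Hash}
    (hrec : e.Receives k i j (.newLeader u w (some x) D))
    (hD : PreparedCert P.f D w (P.hash x)) : P.valid x := by
  obtain ⟨Q, hQ, hD⟩ := hD
  -- The quorum is intersected with itself merely to find a correct signer. That signer checked the
  -- validity of a value with the same hash, which is `x` because both values occur in received
  -- messages.
  obtain ⟨l, hl, -, hlc⟩ := hPN.exists_mem_inter hQ hQ
  obtain ⟨s, hs⟩ := he.exists_sends_of_cert hrec hD hl hlc
  obtain ⟨-, -, -, -, j', y, C, hxy, hr, hsafe⟩ := (he.step_of_actor hs.1).of_prepared_mem hs.2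
  obtain ⟨q, -, hq⟩ := he.receives_of_mem_received hlc s hr
  rw [he.collision_free x y (occurs_of_receives hrec rfl) (occurs_of_receives hq rfl) hxy]
  exact hsafe.2.1

/-- At most one value can be certified in a view. -/
theorem eq_of_cert (hPN : P.Admissible N) (he : e.IsExecution N) {i i' j j' : Fin P.n}
    {k k' u u' w : ℕ} {x x' : Value} {D D' : Cert P.n Hash}
    (hrec : e.Receives k i j (.newLeader u w (some x) D))
    (hrec' : e.Receives k' i' j' (.newLeader u' w (some x') D'))
    (hD : PreparedCert P.f D w (P.hash x)) (hD' : PreparedCert P.f D' w (P.hash x')) :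
    x = x' := by
  obtain ⟨Q, hQ, hD⟩ := hD
  obtain ⟨Q', hQ', hD'⟩ := hD'
  obtain ⟨l, hl, hl', hlc⟩ := hPN.exists_mem_inter hQ hQ'
  obtain ⟨s, hs⟩ := he.exists_sends_of_cert hrec hD hl hlc
  obtain ⟨s', hs'⟩ := he.exists_sends_of_cert hrec' hD' hl' hlc
  exact he.collision_free x x' (occurs_of_receives hrec rfl) (occurs_of_receives hrec' rfl)
    (he.prepared_unique hlc hs hs')

/-- The proposal of a correct leader is safe for every correct process from which the leader has
received a `NEWLEADER` message. -/
theorem safeProposal (hPN : P.Admissible N) (he : e.IsExecution N) {u s k : ℕ} {x : Value}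
    {C : Cert P.n Hash} {i j : Fin P.n} (hi : i ∈ N.correct) (hj : j ∈ N.correct)
    (hsend : e.Sends s j (.propose u x C))
    (hNL : ∃ w val D, (i, .newLeader u w val D) ∈ (e.state s j).received ∧
      P.ValidNewLeader u w val D)
    (hsk : s < k) (hu : (e.state k i).currView = u) (hv : (e.state k i).voted = false) :
    P.SafeProposal (e.state k i) j u x C := by
  obtain ⟨-, -, hl, -, S, sel, hS, hsel, hch⟩ := (he.step_of_actor hsend.1).of_propose_mem hsend.2
  have hiS := (hS i).2 hNL
  obtain ⟨q, hq, hrec⟩ := he.receives_of_mem_received hj s (hsel i hiS).1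
  obtain ⟨q', hq', hsent⟩ := he.authentic q j i _ hi hrec
  -- Process `i` has not voted in view `u` yet, so its prepared value and its lock are still those
  -- reported to the leader.
  obtain ⟨h1, h2⟩ := (he.eq_of_sends_newLeader hi hsent k (by omega)).2 hu.symm hv
  have hlock := (he.coherent hi k).locked_eq
  have hval := (hsel i hiS).2.2
  rcases hch with ⟨l, hlS, hl0, hmax, hx, hC⟩ | ⟨h0, hx, hC⟩
  · obtain ⟨p, -, hrec'⟩ := he.receives_of_mem_received hj s (hsel l hlS).1
    obtain ⟨hlt, hcert⟩ := (hsel l hlS).2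
    obtain ⟨y, hy, hcert⟩ := hcert hl0
    rw [hx] at hy hrec'
    obtain rfl := Option.some.inj hy
    refine ⟨hl, he.valid_of_cert hPN hrec' hcert, fun hne => ?_⟩
    -- The selected view is at least that of `i`'s lock. If it is larger, the attached certificate
    -- overrides the lock; if it is equal, the two certified values coincide.
    have hle := hmax i hiS
    rcases hle.lt_or_eq with hlt' | heq
    · exact Or.inr ⟨(sel l).1, by omega, hlt, hC ▸ hcert⟩
    · left
      obtain ⟨y, hy, hcert'⟩ := hval (by omega)
      rw [hy, heq] at hrec
      rw [heq] at hcert'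
      rw [← h2, hy, he.eq_of_cert hPN hrec' hrec hcert hcert']
  · refine ⟨hl, hx ▸ hPN.myval_valid j hj, fun hne => ?_⟩
    have := h0 i hiS
    omega

end IsExecution

/-! ### Decision in a stable view -/

/-- A view `w` with a correct leader in which all correct processes stay together for long enough,
`t₀` being the time when the first of them enters. -/
structure Stable (e : Trace P) (N : Env P.n) (w : ℕ) (t₀ : ℝ) : Prop where
  pos : 0 < w
  leader_correct : P.leader w ∈ N.correct
  GST_le : N.GST ≤ t₀
  le_of_enters : ∀ i ∈ N.correct, ∀ r, e.Enters r i w → t₀ ≤ e.time (r + 1)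
  currView_eq : ∀ i ∈ N.correct, ∀ t, t₀ + 2 * N.δ ≤ t → t < t₀ + P.F w →
    (e.state (e.stepsBy t) i).currView = w
  Fp_gt : 3 * N.δ < P.Fp w
  F_gt : 5 * N.δ < P.F w - P.Fp w

namespace Stable

variable {w : ℕ} {t₀ : ℝ}

/-- Even the first entry into `w` is after `GST`, so everything sent in view `w` is subject to the
delivery bound `δ`. -/
theorem GST_le_of_currView (h : e.Stable N w t₀) (he : e.IsExecution N) {i : Fin P.n}
    (hi : i ∈ N.correct) {s : ℕ} (hs : (e.state s i).currView = w) :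
    N.GST ≤ e.time (s + 1) := by
  obtain ⟨r, hr, hE⟩ := he.exists_enters hi h.pos hs
  exact h.GST_le.trans ((h.le_of_enters i hi r hE).trans (he.time_mono (by omega)))

/-- The leader makes its proposal in time, but not before having heard from all correct
processes. -/
theorem exists_propose (h : e.Stable N w t₀) (hPN : P.Admissible N) (he : e.IsExecution N)
    {r : ℕ} (hr : e.Enters r (P.leader w) w) :
    ∃ s x C, e.Sends s (P.leader w) (.propose w x C) ∧
      e.time (s + 1) ≤ e.time (r + 1) + P.Fp w ∧ t₀ + 3 * N.δ < e.time (s + 1) := by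
  have hδ := hPN.δ_pos
  have hG := hPN.GST_nonneg
  have hFp := h.Fp_gt
  have hF := h.F_gt
  have hG' := h.GST_le
  have hlc := h.leader_correct
  have hr0 := h.le_of_enters _ hlc r hr
  have hr1 := he.lt_stepsBy_iff.1 (IsExecution.Enters.lt_of_le he hlc hr
    (h.currView_eq _ hlc (t₀ + 2 * N.δ) le_rfl (by linarith)).ge)
  have hsteps : ∃ s x C, e.Sends s (P.leader w) (.propose w x C) ∧
      e.time (s + 1) ≤ e.time (r + 1) + P.Fp w := by
    -- When its timer expires, between `t₀ + 3δ` and `t₀ + 2δ + F_p w < t₀ + F w`, the leader is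
    -- still in view `w`.
    have hcur := h.currView_eq _ hlc (e.time (r + 1) + P.Fp w) (by linarith) (by linarith)
    rcases he.newLeaderTimer_eq hlc hr rfl (e.stepsBy (e.time (r + 1) + P.Fp w))
      (he.lt_stepsBy_iff.2 (by linarith)) hcur with hT | ⟨-, s, hs, x, C, hsend⟩
    · obtain ⟨x, C, hx⟩ := Protocol.exists_choosesProposal (P.leader w)
        (e.state (e.stepsBy (e.time (r + 1) + P.Fp w)) (P.leader w))
        (e.state (e.stepsBy (e.time (r + 1) + P.Fp w)) (P.leader w)).currView
      refine absurd (.propose _ _ x C hT ?_ (by rw [hcur]) hx)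
        (he.not_step_stepsBy (by linarith) hlc (a := .propose) trivial)
      rw [hPN.clock_add hlc (by linarith) (by linarith)]
    · exact ⟨s, x, C, hsend, he.lt_stepsBy_iff.1 hs⟩
  obtain ⟨s, x, C, hsend, hs⟩ := hsteps
  refine ⟨s, x, C, hsend, hs, ?_⟩
  obtain ⟨-, h1, -, ⟨d, hd, hdc⟩, -⟩ := (he.step_of_actor hsend.1).of_propose_mem hsend.2
  have hrs := IsExecution.Enters.lt_of_le he hlc hr h1.ge
  rcases he.newLeaderTimer_eq hlc hr rfl s hrs h1 with hT | hT
  · rw [hT] at hd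
    have := hPN.le_of_clock_le hlc (hG'.trans hr0) (he.time_mono (by omega))
      ((Option.some.inj hd).le.trans hdc)
    linarith
  · rw [hT.1] at hd
    exact Option.noConfusion rfl (heq_of_eq hd)

variable {s : ℕ} {x : Value} {C : Cert P.n Hash} {i : Fin P.n} {t : ℝ}

/-- All correct processes vote for the proposal of the leader. -/
theorem voted (h : e.Stable N w t₀) (hPN : P.Admissible N) (he : e.IsExecution N)
    (hsend : e.Sends s (P.leader w) (.propose w x C)) (hs : t₀ + 3 * N.δ < e.time (s + 1))
    (hi : i ∈ N.correct) (ht : e.time (s + 1) + N.δ ≤ t) (ht' : t < t₀ + P.F w) :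
    (e.state (e.stepsBy t) i).voted = true ∧ (e.state (e.stepsBy t) i).currVal = some x ∧
      ∃ q < e.stepsBy t, e.Sends q i (.prepared w (P.hash x)) := by
  have hδ := hPN.δ_pos
  have hG := hPN.GST_nonneg
  have hFp := h.Fp_gt
  have hF := h.F_gt
  have hG' := h.GST_le
  have hlc := h.leader_correct
  have hcur := h.currView_eq i hi t (by linarith) ht'
  have hrec := he.mem_received_of_sends hi hsend (by simp) trivial (by linarith) ht
  have hv : (e.state (e.stepsBy t) i).voted = true := by
    by_contra hv
    rw [Bool.not_eq_true] at hv
    -- Process `i` entered `w` by `t₀ + 2δ`, so its `NEWLEADER` message reached the leader by `t₀ +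
    -- 3δ`, before the proposal was made.
    have hcur2 := h.currView_eq i hi (t₀ + 2 * N.δ) le_rfl (by linarith)
    obtain ⟨r, hr, hE⟩ := he.exists_enters hi h.pos hcur2
    obtain ⟨w', val, D, hNL, hvalid⟩ := he.exists_sends_newLeader hi hE
    have hrt := he.lt_stepsBy_iff.1 hr
    have hrecNL := he.mem_received_of_sends hlc hNL (by simp) rfl
      (hG'.trans (h.le_of_enters i hi r hE)) (t := t₀ + 3 * N.δ) (by linarith)
    have hle : e.stepsBy (t₀ + 3 * N.δ) ≤ s := by
      by_contra! hlt
      exact absurd (he.lt_stepsBy_iff.1 hlt) (not_le.2 hs)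
    have hsafe := he.safeProposal hPN hi hlc hsend
      ⟨w', val, D, he.received_mono hlc hle hrecNL, hvalid⟩
      (he.lt_stepsBy_iff.2 (by linarith)) hcur hv
    rw [← hcur] at hrec hsafe
    refine he.not_step_stepsBy (by linarith) hi (a := .vote) trivial
      (.vote _ _ x C (by rw [hcur]; exact h.pos) hrec hv hsafe)
  refine ⟨hv, ?_⟩
  -- The vote may have been cast at any time in this view, but it answers the leader's only proposal
  -- and is therefore for `x`.
  obtain ⟨q, hq, y, D, hy, hqs, hr⟩ := he.exists_vote hi _ hv
  rw [hcur] at hr hqs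
  obtain ⟨p, -, hp⟩ := he.receives_of_mem_received hi _ hr
  obtain ⟨p', -, hp'⟩ := he.authentic p i _ _ hlc hp
  obtain rfl := he.propose_unique hlc hsend hp'
  exact ⟨hy, q, hq, hqs⟩

/-- All correct processes lock on the proposal of the leader. -/
theorem locked (h : e.Stable N w t₀) (hPN : P.Admissible N) (he : e.IsExecution N)
    (hsend : e.Sends s (P.leader w) (.propose w x C)) (hs : t₀ + 3 * N.δ < e.time (s + 1))
    (hi : i ∈ N.correct) (ht : e.time (s + 1) + 2 * N.δ ≤ t) (ht' : t < t₀ + P.F w) :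
    (e.state (e.stepsBy t) i).lockedView = w ∧
      ∃ q < e.stepsBy t, e.Sends q i (.committed w (P.hash x)) := by
  have hδ := hPN.δ_pos
  have hG := hPN.GST_nonneg
  have hG' := h.GST_le
  have hcur := h.currView_eq i hi t (by linarith) ht'
  obtain ⟨hv, hx, -⟩ := h.voted hPN he hsend hs hi (t := t) (by linarith) ht'
  obtain ⟨Q, hQ, hQcard⟩ := hPN.exists_quorum
  have hlock : (e.state (e.stepsBy t) i).lockedView = (e.state (e.stepsBy t) i).currView := by
    by_contra hlock
    refine he.not_step_stepsBy (by linarith) hi (a := .prepare) trivial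
      (.prepare _ Q x hQcard (fun j hj => ?_) hv hx hlock)
    obtain ⟨-, -, q, hq, hqs⟩ := h.voted hPN he hsend hs (hQ hj) le_rfl (by linarith)
    rw [hcur]
    have hq' := he.lt_stepsBy_iff.1 hq
    exact he.mem_received_of_sends hi hqs (by simp) trivial
      (h.GST_le_of_currView he (hQ hj) ((he.step_of_actor hqs.1).of_prepared_mem hqs.2).2.1)
      (by linarith)
  obtain ⟨q, hq, y, hy, hqs⟩ := he.exists_sends_committed hi _ (by rw [hcur]; exact h.pos) hlock
  rw [hx] at hy
  obtain rfl := Option.some.inj hy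
  rw [hcur] at hqs hlock
  exact ⟨hlock, q, hq, hqs⟩

/-- All correct processes decide in a stable view. -/
theorem decidesBy (h : e.Stable N w t₀) (hPN : P.Admissible N) (he : e.IsExecution N)
    {r : ℕ} (hr : e.Enters r (P.leader w) w) (hr' : e.time (r + 1) ≤ t₀ + 2 * N.δ)
    (hi : i ∈ N.correct) : e.DecidesBy i (e.time (r + 1) + P.Fp w + 3 * N.δ) := by
  have hδ := hPN.δ_pos
  have hG := hPN.GST_nonneg
  have hF := h.F_gt
  have hG' := h.GST_le
  obtain ⟨s, x, C, hsend, hs1, hs⟩ := h.exists_propose hPN he hr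
  obtain ⟨t, ht⟩ : ∃ t, t = e.time (s + 1) + 3 * N.δ := ⟨_, rfl⟩
  -- The budget: `2δ` until the leader enters, `F_p w` until it proposes, and `3δ` for `PROPOSE`,
  -- `PREPARED` and `COMMITTED`.
  have ht' : t < t₀ + P.F w := by linarith
  have hcur := h.currView_eq i hi t (by linarith) ht'
  obtain ⟨hv, hx, -⟩ := h.voted hPN he hsend hs hi (t := t) (by linarith) ht'
  obtain ⟨hlock, -⟩ := h.locked hPN he hsend hs hi (t := t) (by linarith) ht'
  obtain ⟨Q, hQ, hQcard⟩ := hPN.exists_quorum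
  have hd : (e.state (e.stepsBy t) i).decided ≠ none := by
    intro hd
    refine he.not_step_stepsBy (by linarith) hi (a := .decide x) trivial
      (.decide _ Q x (by rw [hcur]; exact h.pos) hQcard (fun j hj => ?_) (by rw [hlock, hcur])
        hx hd)
    obtain ⟨-, q, hq, hqs⟩ := h.locked hPN he hsend hs (hQ hj) le_rfl (by linarith)
    rw [hcur]
    have hq' := he.lt_stepsBy_iff.1 hq
    exact he.mem_received_of_sends hi hqs (by simp) trivial
      (h.GST_le_of_currView he (hQ hj) ((he.step_of_actor hqs.1).of_committed_mem hqs.2))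
      (by linarith)
  obtain ⟨q, hq, y, hqa, hqd⟩ := he.exists_decide hi _ hd
  have := he.lt_stepsBy_iff.1 hq
  exact ⟨q, y, hqa, hqd, by linarith⟩

end Stable
end Trace
/-! ### Progress through the views -/

namespace Trace

variable {Value Hash : Type*} {P : Protocol Value Hash} {N : Env P.n} {e : Trace P}

namespace IsExecution

/-- Only finitely many steps are taken by time `t`. Without boundedness, the supremum of naturals in
`LV` would take the default value `0`. -/
theorem bddAbove_enteredBy (he : e.IsExecution N) {i : Fin P.n} (t : ℝ) :
    BddAbove {v | e.EnteredBy i v t} := by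
  refine ⟨(Finset.range (e.stepsBy t)).sup fun k => (e.state (k + 1) i).currView, ?_⟩
  rintro v ⟨k, hk, -, rfl⟩
  exact Finset.le_sup (f := fun k => (e.state (k + 1) i).currView)
    (Finset.mem_range.2 (he.lt_stepsBy_iff.2 hk))

theorem lt_time_of_enters (he : e.IsExecution N) {i : Fin P.n} (hi : i ∈ N.correct) {r w : ℕ}
    {t : ℝ} (hE : e.Enters r i w) (hw : e.GV N t < w) : t < e.time (r + 1) := by
  by_contra! hle
  have h1 : w ≤ e.LV i t := le_csSup (he.bddAbove_enteredBy t) ⟨r, hle, hE.2.1.ne, hE.2.2⟩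
  have h2 : e.LV i t ≤ e.GV N t := Finset.le_sup (f := fun i => e.LV i t) hi
  omega

theorem exists_enteredBy_GV (hPN : P.Admissible N) (he : e.IsExecution N) {t : ℝ}
    (h : 0 < e.GV N t) : ∃ i ∈ N.correct, e.EnteredBy i (e.GV N t) t := by
  have hne : N.correct.Nonempty := Finset.card_pos.1 (by have := hPN.le_card_correct; omega)
  obtain ⟨i, hi, hGV⟩ := Finset.exists_mem_eq_sup N.correct hne fun i => e.LV i t
  have hGV : e.GV N t = e.LV i t := hGV
  refine ⟨i, hi, ?_⟩
  rw [hGV]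
  refine Nat.sSup_mem ?_ (he.bddAbove_enteredBy t)
  by_contra hempty
  rw [Set.not_nonempty_iff_eq_empty] at hempty
  have : e.LV i t = 0 := by simp [LV, hempty]
  omega

/-- The infimum in the definition of `tFirst` is attained. -/
theorem card_started_of_tFirst_le (hPN : P.Admissible N) {m : ℕ} (hm : m ≤ P.f + 1) {t : ℝ}
    (h : e.tFirst N m ≤ t) : m ≤ (N.correct.filter fun i => e.startTime i ≤ t).card := by
  have hncard : ∀ t, {i | i ∈ N.correct ∧ e.startTime i ≤ t}.ncard =
      (N.correct.filter fun i => e.startTime i ≤ t).card := fun t => by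
    rw [← Set.ncard_coe_finset]
    congr 1
    ext i
    simp
  obtain ⟨u, htu, hu⟩ : ∃ u > t, ∀ i, t < e.startTime i → u < e.startTime i := by
    have hev : ∀ᶠ u in nhdsWithin t (Set.Ioi t), ∀ i, t < e.startTime i → u < e.startTime i := by
      rw [Filter.eventually_all]
      intro i
      by_cases hi : t < e.startTime i
      · filter_upwards [Ioo_mem_nhdsGT hi] with u hu _ using hu.2
      · exact Filter.Eventually.of_forall fun u h => absurd h hi
    obtain ⟨u, hu, hut⟩ := (hev.and self_mem_nhdsWithin).exists
    exact ⟨u, hut, hu⟩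
  have hne : {t | m ≤ {i | i ∈ N.correct ∧ e.startTime i ≤ t}.ncard}.Nonempty := by
    obtain ⟨b, hb⟩ := (Set.finite_range e.startTime).bddAbove
    refine ⟨b, ?_⟩
    rw [Set.mem_ofPred_eq, hncard, Finset.filter_true_of_mem fun i _ => hb ⟨i, rfl⟩]
    have := hPN.le_card_correct
    omega
  obtain ⟨s, hs, hsu⟩ := exists_lt_of_csInf_lt hne (lt_of_le_of_lt h htu)
  rw [Set.mem_ofPred_eq, hncard] at hs
  refine hs.trans (Finset.card_le_card fun i hi => ?_)
  rw [Finset.mem_filter] at hi ⊢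
  refine ⟨hi.1, ?_⟩
  by_contra! hlt
  linarith [hu i hlt, hi.2]

/-- If `start()` stays silent because `view⁺ > 0`, the process has already wished for its `view⁺`.
-/
theorem wished_one_of_started (he : e.IsExecution N) {i : Fin P.n} (hi : i ∈ N.correct) {t : ℝ}
    (h : e.startTime i ≤ t) : e.Wished i 1 (e.stepsBy t) := by
  obtain ⟨k, hk, hka, hkt⟩ := he.start_called i hi
  have hlt : k < e.stepsBy t := he.lt_stepsBy_iff.2 (hkt.trans_le h)
  by_cases hp : (e.state k i).viewPlus = 0
  · refine ⟨k, hlt, 1, le_rfl, hk, ?_⟩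
    have hstep := he.step_of_actor hk
    rw [hka] at hstep
    generalize e.state (k + 1) i = σ' at hstep
    generalize e.sent k = out at hstep ⊢
    cases hstep
    rw [if_pos hp]
    rfl
  · exact (he.wished_viewPlus hi one_pos k (by omega)).mono le_rfl hlt.le

/-- All correct processes soon reach a view higher than all those entered by time
`GST + ρ`. -/
theorem GV_lt_view (hPN : P.Admissible N) (he : e.IsExecution N)
    (hstart : e.tFirst N (P.f + 1) ≤ N.GST + P.ρ) {j : Fin P.n} (hj : j ∈ N.correct) :
    e.GV N (N.GST + P.ρ) + 1 ≤ (e.state (e.stepsBy (N.GST + P.ρ +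
      (P.F (e.GV N (N.GST + P.ρ)) + N.δ) + 2 * N.δ)) j).view := by
  have hδ := hPN.δ_pos
  -- If no view has been entered, the `f + 1` processes that have started bring everyone to view `1`
  -- within `2δ`. Otherwise everyone catches up with the global view within `2δ` and leaves it after
  -- a further `F + δ`; as `F 0 = 0`, this bound covers both cases.
  rcases Nat.eq_zero_or_pos (e.GV N (N.GST + P.ρ)) with h0 | hpos
  · rw [h0, hPN.F_zero]
    have hle := he.le_view_of_wished hPN one_pos le_rfl (Finset.filter_subset _ _)
      (card_started_of_tFirst_le hPN le_rfl hstart) (fun i hi =>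
        he.wished_one_of_started (Finset.mem_filter.1 hi).1 (Finset.mem_filter.1 hi).2) hj
    exact hle.trans (he.view_mono hj (he.stepsBy_mono (by linarith)))
  · obtain ⟨i, hi, k, hk, -, hkv⟩ := he.exists_enteredBy_GV hPN hpos
    obtain ⟨A, hA, hcard, hAw⟩ := he.wished_of_le_view hPN hi (k := k + 1) hpos
      (hkv.ge.trans (he.synced hi _).currView_le)
    have hall : ∀ l ∈ N.correct, e.GV N (N.GST + P.ρ) ≤
        (e.state (e.stepsBy (N.GST + P.ρ + 2 * N.δ)) l).view := fun l hl =>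
      he.le_view_of_wished hPN hpos le_rfl hA hcard (fun m hm =>
        (hAw m hm).mono le_rfl (he.lt_stepsBy_iff.2 hk).le) hl
    have := he.le_view_succ hPN hpos (t := N.GST + P.ρ + 2 * N.δ) (by linarith) hall hj
    convert this using 4
    ring

/-- Upper bound on the time by which all correct processes reach view `v + d`. -/
theorem le_view_of_sum (hPN : P.Admissible N) (he : e.IsExecution N)
    (hstart : e.tFirst N (P.f + 1) ≤ N.GST + P.ρ) (d : ℕ) :
    ∀ j ∈ N.correct, e.GV N (N.GST + P.ρ) + 1 + d ≤ (e.state (e.stepsBy (N.GST + P.ρ +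
      ∑ k ∈ Finset.Ico (e.GV N (N.GST + P.ρ)) (e.GV N (N.GST + P.ρ) + 1 + d), (P.F k + N.δ) +
      2 * N.δ)) j).view := by
  have hδ := hPN.δ_pos
  induction d with
  | zero =>
    intro j hj
    simpa using he.GV_lt_view hPN hstart hj
  | succ d ih =>
    intro j hj
    have hsum : 0 ≤ ∑ k ∈ Finset.Ico (e.GV N (N.GST + P.ρ)) (e.GV N (N.GST + P.ρ) + 1 + d),
        (P.F k + N.δ) := Finset.sum_nonneg fun k _ => add_nonneg (hPN.F_nonneg k) hδ.le
    have := he.le_view_succ hPN (by omega) (by linarith) ih hj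
    rw [← add_assoc, Finset.sum_Ico_succ_top (by omega)]
    convert this using 4
    ring

/-- A view with a correct leader which no process enters by `GST + ρ` is stable, and its leader
enters it soon after all processes have reached it. -/
theorem exists_stable (hPN : P.Admissible N) (he : e.IsExecution N) {w : ℕ} (hw : 0 < w)
    (hlc : P.leader w ∈ N.correct)
    (hlate : ∀ i ∈ N.correct, ∀ r, e.Enters r i w → N.GST + P.ρ < e.time (r + 1))
    (hFp : 3 * N.δ < P.Fp w) (hF : 5 * N.δ < P.F w - P.Fp w) {b : ℝ} (hb : N.GST + P.ρ ≤ b)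
    (hview : ∀ i ∈ N.correct, w ≤ (e.state (e.stepsBy b) i).view) :
    ∃ t₀ r, e.Stable N w t₀ ∧ e.Enters r (P.leader w) w ∧ e.time (r + 1) ≤ t₀ + 2 * N.δ ∧
      e.time (r + 1) ≤ b := by
  have hδ := hPN.δ_pos
  have hρ := hPN.ρ_pos
  have hG := hPN.GST_nonneg
  -- Having `view ≥ w` does not mean having entered `w`, which is skipped if `view⁺` is ahead. That
  -- somebody enters `w` follows from the wishes for `w + 1`, which exist because all processes
  -- eventually move on.
  obtain ⟨A, hA, hcard, hAw⟩ := he.wished_of_le_view hPN hlc (Nat.succ_pos w)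
    (he.le_view_succ hPN hw hb hview hlc)
  obtain ⟨j, hj, -⟩ := hPN.exists_mem_correct hcard
  obtain ⟨t₀, ht₀, hfirst, hreach, hstay⟩ := he.exists_first_entry hPN hw hlate (hAw j hj)
  have hcurr : ∀ i ∈ N.correct, ∀ t, 0 ≤ t → t < t₀ + P.F w →
      w ≤ (e.state (e.stepsBy t) i).view → (e.state (e.stepsBy t) i).currView = w :=
    fun i hi t ht ht' hv => (hstay i hi _ ((he.time_stepsBy_le ht).trans_lt ht') hv).2.2
  have hstable : e.Stable N w t₀ := ⟨hw, hlc, by linarith, hfirst, fun i hi t ht ht' =>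
    hcurr i hi t (by linarith) ht'
      ((hreach i hi).trans (he.view_mono hi (he.stepsBy_mono ht))), hFp, hF⟩
  -- At the earlier of the two times the leader has reached `w` and, since `2δ < F w`, cannot have
  -- left it, so it has entered `w` by then. This yields both upper bounds on the entry time.
  have hv : w ≤ (e.state (e.stepsBy (min b (t₀ + 2 * N.δ))) (P.leader w)).view := by
    rcases min_choice b (t₀ + 2 * N.δ) with h | h <;> rw [h]
    · exact hview _ hlc
    · exact hreach _ hlc
  have hmin := min_le_right b (t₀ + 2 * N.δ)
  obtain ⟨r, hr, hE⟩ := he.exists_enters hlc hw (hcurr _ hlc _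
    (le_min (by linarith) (by linarith)) (by linarith) hv)
  have hr := he.lt_stepsBy_iff.1 hr
  exact ⟨t₀, r, hstable, hE, hr.trans hmin, hr.trans (min_le_left _ _)⟩

end IsExecution

theorem DecidesBy.mono {i : Fin P.n} {t t' : ℝ} (h : e.DecidesBy i t) (htt : t ≤ t') :
    e.DecidesBy i t' := by
  obtain ⟨k, x, h1, h2, h3⟩ := h
  exact ⟨k, x, h1, h2, h3.trans htt⟩

end Trace
end TwoPhaseHotStuff

/-! ### The deadline -/

theorem mainTheorem8 {Value Hash : Type*} (P : TwoPhaseHotStuff.Protocol Value Hash)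
    (N : TwoPhaseHotStuff.Env P.n) (hPN : P.Admissible N)
    (e : TwoPhaseHotStuff.Trace P) (he : e.IsExecution N)
    (v : ℕ) (hv : v = e.GV N (N.GST + P.ρ) + 1)
    (hstart : e.tFirst N (P.f + 1) ≤ N.GST + P.ρ)
    (hFp : ∀ k ∈ Finset.Icc v (v + P.f), P.Fp k > 3 * N.δ)
    (hF : ∀ k ∈ Finset.Icc v (v + P.f), P.F k - P.Fp k > 5 * N.δ) :
    ∀ i ∈ N.correct, e.DecidesBy i
      (N.GST + P.ρ + ∑ k ∈ Finset.Icc (v - 1) (v + P.f - 1), (P.F k + N.δ)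
        + P.Fp (v + P.f) + 5 * N.δ) := by
  intro i hi
  have hδ := hPN.δ_pos
  obtain ⟨w, hw, hlc⟩ := hPN.exists_correct_leader (v := v) (by omega)
  have hwI := Finset.mem_Icc.1 hw
  have hGV : e.GV N (N.GST + P.ρ) = v - 1 := by omega
  have hterm : ∀ k, 0 ≤ P.F k + N.δ := fun k => add_nonneg (hPN.F_nonneg k) hδ.le
  have hview := he.le_view_of_sum hPN hstart (w - v)
  have hidx : v - 1 + 1 + (w - v) = w := by omega
  rw [hGV, hidx] at hview
  have hsum : 0 ≤ ∑ k ∈ Finset.Ico (v - 1) w, (P.F k + N.δ) :=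
    Finset.sum_nonneg fun k _ => hterm k
  obtain ⟨t₀, r, hst, hr, hr1, hr2⟩ := he.exists_stable hPN (by omega) hlc
    (fun j hj r hE => he.lt_time_of_enters hj hE (by omega)) (hFp w hw) (hF w hw) (by linarith)
    hview
  refine (hst.decidesBy hPN he hr hr1 hi).mono ?_
  have hIcc : Finset.Icc (v - 1) (v + P.f - 1) = Finset.Ico (v - 1) (v + P.f) := by
    ext k
    simp only [Finset.mem_Icc, Finset.mem_Ico]
    omega
  rw [hIcc]
  -- For `w = v + f` the bound is met exactly, with `5δ = 2δ + 3δ`. For smaller `w`, the summand `F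
  -- w + δ` is not needed for reaching `w` and pays for `F_p w`, while `F_p (v + f)` is positive.
  rcases hwI.2.eq_or_lt with rfl | hlt
  · linarith
  · have hle : ∑ k ∈ Finset.Ico (v - 1) (w + 1), (P.F k + N.δ) ≤
        ∑ k ∈ Finset.Ico (v - 1) (v + P.f), (P.F k + N.δ) :=
      Finset.sum_le_sum_of_subset_of_nonneg (Finset.Ico_subset_Ico_right hlt)
        fun k _ _ => hterm k
    rw [Finset.sum_Ico_succ_top (by omega)] at hle
    have h1 := hF w hw
    have h2 := hFp (v + P.f) (Finset.mem_Icc.2 ⟨by omega, le_rfl⟩)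
    linarith
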